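/- \textbf{Setting.} Let $\rho>1$ be an integer, let $n\ge 0$, and let $H=(V_H,E_H)$ be a finite directed acyclic graph whose vertices belong to an $n$-element set $V$ (the jobs of the whole instance). For a vertex $v$ of $H$ let $A_H(v)$ be the set of vertices of $H$ with a directed path to $v$, including $v$ itself, and let $A_H(S)=\bigcup_{v\in S}A_H(v)$; let $E_H(v)$ and $E_H(S)$ be the sets of edges of $H$ induced by $A_H(v)$ and by $A_H(S)$. For $v\notin V_H$ put $A_H(v)=\emptyset$. Assume that $H$ is small: $|A_H(v)|\le 2\rho$ for all $v\in V_H$. Let $0<\gamma<1/4$ and let $N\ge 1$ be an integer. \textbf{Estimates.} The size of a subset $S$ of a $u$-element universe is estimated as follows, with $t=9c$ (that is, $c/\varepsilon^2$ with $\varepsilon=1/3$) and $k=\lceil c'\ln n\rceil$. Draw $k$ independent uniform members of a given 2-universal (pairwise independent) family of hash functions into $\{1,\dots,u^3\}$. For each of them let $\ell$ be the $t$-th smallest of the distinct hash values of $S$ and take the number $t u^3/\ell$; if there are fewer than $t$ distinct hash values, take their number. The estimate is the median of the $k$ numbers. "Obtain estimates in a graph" means: with newly drawn hash functions (one set for all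 vertices, one set for all edges), compute estimates $\hat a(v)$ of $|A(v)|$ and $\hat e(v)$ of $|E(v)|$ in that graph for all $v$. \textbf{FindBatch.} Start with $B=\emptyset$. Obtain estimates in $H$ and put $v\in V_H$ into the bucket $K_i$ with $2^i\le\hat e(v)<2^{i+1}$, or into $K_0$ if $\hat e(v)<1$. While some bucket is non-empty, do the following. First, for all $i$ in decreasing order, draw vertices $v$ uniformly without replacement from $K_i$ until $K_i$ is empty or $N$ consecutive draws were stale; here $v$ is fresh, and is added to $B$, if $$|A_H(v)\setminus A_H(B)|>\gamma|A_H(v)|\quad\text{and}\quad \bigl(E_H(v)=\emptyset\ \text{ or }\ |E_H(v)\setminus E_H(B)|>\gamma|E_H(v)|\bigr),$$ and it is stale otherwise. Then prune: obtain new estimates $\hat a,\hat e$ in $H$ and $\hat a',\hat e'$ in $H\setminus A_H(B)$, and remove from its bucket each $v$ with $\hat a'(v)/\hat a(v)\le 2\gamma$, or with $\hat e(v)\ne 0$ and $\hat e'(v)/\hat e(v)\le 2\gamma$. When all buckets are empty, return the batch $B$. \textbf{ScheduleSmallSubgraph.} While $H$ is non-empty, let $B$ be the result of FindBatch for $H$,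 schedule $A_H(v)$ for all $v\in B$, and remove the vertices in $A_H(B)$ and all edges adjacent to them from $H$. \textbf{Lemma.} With high probability, the number of batches that ScheduleSmallSubgraph needs before all vertices of $H$ are scheduled is at most $$\max\bigl\{3,\ 4\log_{1/(4\gamma)}(2\rho)\bigr\}.$$ Precisely: for every sufficiently large integer $c$ and every real $d\ge1$ there is $c_1$ such that for all integers $c'\ge c_1$ and all $V$, $H$, $\rho$, $\gamma$, $N$ and hash families as above, the bound holds with probability at least $1-1/n^d$. -/

import Mathlib

namespace BatchScheduling

noncomputable section

open scoped Classical

/-! ### Precedence graphs -/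

/-- A finite directed acyclic graph whose vertices are among the elements of `V`. -/
structure DAG (V : Type*) where
  verts : Finset V
  edges : Finset (V × V)
  edges_mem : ∀ e ∈ edges, e.1 ∈ verts ∧ e.2 ∈ verts
  acyclic : ∀ v, ¬ Relation.TransGen (fun a b => (a, b) ∈ edges) v v

namespace DAG

variable {V : Type*}

/-- The ancestors of `v` in `H`, that is, the vertices of `H` with a directed path (possibly of
length zero) to `v`. A vertex of `H` is an ancestor of itself; if `v` is not a vertex of `H`, the
set is empty. -/
def anc (H : DAG V) (v : V) : Finset V :=
  H.verts.filter fun u => Relation.ReflTransGen (fun a b => (a, b) ∈ H.edges) u v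

/-- The ancestors of a set of vertices. -/
def ancSet (H : DAG V) (S : Finset V) : Finset V := S.biUnion H.anc

/-- The edges of the subgraph of `H` induced by the vertex set `A`. -/
def inducedEdges (H : DAG V) (A : Finset V) : Finset (V × V) :=
  H.edges.filter fun e => e.1 ∈ A ∧ e.2 ∈ A

/-- The edges induced by the ancestors of `v`. -/
def ancEdges (H : DAG V) (v : V) : Finset (V × V) := H.inducedEdges (H.anc v)

/-- The edges induced by the ancestors of a set of vertices. -/
def ancEdgesSet (H : DAG V) (S : Finset V) : Finset (V × V) := H.inducedEdges (H.ancSet S)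

/-- `H` with the vertices in `A` and all edges adjacent to them removed. -/
def remove (H : DAG V) (A : Finset V) : DAG V where
  verts := H.verts \ A
  edges := H.edges.filter fun e => e.1 ∉ A ∧ e.2 ∉ A
  edges_mem := by
    intro e he
    rw [Finset.mem_filter] at he
    have h := H.edges_mem e he.1
    exact ⟨Finset.mem_sdiff.2 ⟨h.1, he.2.1⟩, Finset.mem_sdiff.2 ⟨h.2, he.2.2⟩⟩
  acyclic := by
    intro v hv
    have key : ∀ a b, Relation.TransGen
        (fun a b => (a, b) ∈ H.edges.filter fun e => e.1 ∉ A ∧ e.2 ∉ A) a b →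
        Relation.TransGen (fun a b => (a, b) ∈ H.edges) a b := by
      intro a b h
      induction h with
      | single h => exact Relation.TransGen.single (Finset.mem_filter.1 h).1
      | tail _ h ih => exact ih.tail (Finset.mem_filter.1 h).1
    exact H.acyclic v (key v v hv)

/-- A small subgraph: each vertex has at most `2ρ` ancestors. -/
def IsSmall (H : DAG V) (ρ : ℕ) : Prop := ∀ v ∈ H.verts, (H.anc v).card ≤ 2 * ρ

theorem self_mem_anc (H : DAG V) {v : V} (hv : v ∈ H.verts) : v ∈ H.anc v :=
  Finset.mem_filter.2 ⟨hv, Relation.ReflTransGen.refl⟩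

end DAG

/-! ### The count-distinct estimator -/

/-- A 2-universal (pairwise independent) family of hash functions from `U` to a set of `N` hash
values: for a uniformly random seed, any two distinct elements of `U` have independent, uniformly
distributed hash values. -/
structure HashFamily (U : Type*) (N : ℕ) where
  Seed : Type
  [fintypeSeed : Fintype Seed]
  [nonemptySeed : Nonempty Seed]
  hash : Seed → U → Fin N
  two_universal : ∀ x y : U, x ≠ y → ∀ a b : Fin N,
    (Finset.univ.filter fun s : Seed => hash s x = a ∧ hash s y = b).card * N ^ 2 =
      Fintype.card Seed

attribute [instance] HashFamily.fintypeSeed HashFamily.nonemptySeed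

/-- The (at most) `t` smallest distinct hash values, in increasing order, of the elements of `S`.
Hash values range over `1, …, N`. -/
def smallestValues {U : Type*} {N : ℕ} (t : ℕ) (h : U → Fin N) (S : Finset U) : List ℕ :=
  ((S.image fun x => (h x : ℕ) + 1).sort (· ≤ ·)).take t

/-- The estimate of `|S|` from one hash function: `tN/ℓ` with `ℓ` the `t`-th smallest hash value;
if there are fewer than `t` hash values, their number. -/
def singleEstimate {U : Type*} {N : ℕ} (t : ℕ) (h : U → Fin N) (S : Finset U) : ℝ :=
  if (smallestValues t h S).length < t then ((smallestValues t h S).length : ℝ)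
  else (t : ℝ) * (N : ℝ) / (((smallestValues t h S).getLastD 1 : ℕ) : ℝ)

/-- The median of a list of real numbers (the upper one for a list of even length). -/
def median (l : List ℝ) : ℝ := (l.insertionSort (· ≤ ·)).getD (l.length / 2) 0

/-- The estimate of `|S|` from `k` hash functions: the median of the single estimates. -/
def estimate {U : Type*} {N : ℕ} (F : HashFamily U N) (t k : ℕ) (seeds : Fin k → F.Seed)
    (S : Finset U) : ℝ :=
  median (List.ofFn fun i => singleEstimate t (F.hash (seeds i)) S)

/-! ### The scheduling algorithm -/

/-- The parameters of the algorithm: the freshness threshold `γ`, the number `N` of consecutive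
stale vertices after which the sampling of a bucket stops, the number `t` of hash values kept for
each hash function, the number `k` of hash functions of an estimator, and the hash families for
vertices and for edges (a set of size `u` is hashed to `u ^ 3` values). -/
structure Params (V : Type*) [Fintype V] where
  γ : ℝ
  γ_pos : 0 < γ
  γ_lt : γ < 1 / 2
  N : ℕ
  N_pos : 0 < N
  t : ℕ
  k : ℕ
  vertHash : HashFamily V (Fintype.card V ^ 3)
  edgeHash : HashFamily (V × V) (Fintype.card (V × V) ^ 3)

variable {V : Type*} [Fintype V]

/-- Estimates, with newly drawn independent uniform hash functions, of the number of ancestors and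
of the number of ancestor edges of all vertices in `H`. -/
def estimates (P : Params V) (H : DAG V) : PMF ((V → ℝ) × (V → ℝ)) :=
  (PMF.uniformOfFintype (Fin P.k → P.vertHash.Seed)).bind fun σ =>
    (PMF.uniformOfFintype (Fin P.k → P.edgeHash.Seed)).bind fun τ =>
      PMF.pure (fun v => estimate P.vertHash P.t P.k σ (H.anc v),
        fun v => estimate P.edgeHash P.t P.k τ (H.ancEdges v))

/-- `v` is fresh with respect to the current batch `B`: more than a `γ`-fraction of its ancestors
and of its ancestor edges is not yet covered by `B`. If there are no ancestor edges, there is no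
condition on them. -/
def Fresh (P : Params V) (H : DAG V) (B : Finset V) (v : V) : Prop :=
  P.γ * ((H.anc v).card : ℝ) < ((H.anc v \ H.ancSet B).card : ℝ) ∧
    (H.ancEdges v = ∅ ∨
      P.γ * ((H.ancEdges v).card : ℝ) < ((H.ancEdges v \ H.ancEdgesSet B).card : ℝ))

/-- The index `i` with `2 ^ i ≤ x < 2 ^ (i + 1)`; the smallest index, `0`, if `x < 1`. -/
def bucketIndex (x : ℝ) : ℕ := Nat.log 2 ⌊x⌋₊

/-- The `i`-th bucket, where `R` is the set of all vertices that are still in some bucket and `idx`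
assigns to each vertex the index of its bucket. -/
def bucket (idx : V → ℕ) (i : ℕ) (R : Finset V) : Finset V := R.filter fun v => idx v = i

/-- Sample uniformly without replacement from the `i`-th bucket, adding the fresh vertices to the
batch `B`, until the bucket is empty or `N` consecutive samples were stale (`s` counts them).
Returns the vertices still in buckets and the new batch. -/
def sampleBucket (P : Params V) (H : DAG V) (idx : V → ℕ) (i : ℕ)
    (R B : Finset V) (s : ℕ) : PMF (Finset V × Finset V) :=
  if h : s < P.N ∧ (bucket idx i R).Nonempty then
    (PMF.uniformOfFinset (bucket idx i R) h.2).bindOnSupport fun v hv =>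
      if Fresh P H B v then sampleBucket P H idx i (R.erase v) (insert v B) 0
      else sampleBucket P H idx i (R.erase v) B (s + 1)
  else PMF.pure (R, B)
termination_by R.card
decreasing_by
  all_goals
    rw [PMF.mem_support_uniformOfFinset_iff] at hv
    exact Finset.card_erase_lt_of_mem (Finset.mem_filter.1 hv).1

/-- Sample from the buckets `j - 1, …, 1, 0`, in this order. -/
def sampleBuckets (P : Params V) (H : DAG V) (idx : V → ℕ) :
    ℕ → Finset V → Finset V → PMF (Finset V × Finset V)
  | 0, R, B => PMF.pure (R, B)
  | j + 1, R, B => (sampleBucket P H idx j R B 0).bind fun r => sampleBuckets P H idx j r.1 r.2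

/-- Prune the buckets: estimate again in `H` and in `H` without the ancestors of `B`, and remove
the vertices for which one of the two ratios of the estimates is at most `2γ`. There is no ratio
for the edges if their number is estimated to be zero in `H`. -/
def prune (P : Params V) (H : DAG V) (B R : Finset V) : PMF (Finset V) :=
  (estimates P H).bind fun e =>
    (estimates P (H.remove (H.ancSet B))).bind fun e' =>
      PMF.pure (R.filter fun v =>
        ¬ (e'.1 v / e.1 v ≤ 2 * P.γ ∨ (e.2 v ≠ 0 ∧ e'.2 v / e.2 v ≤ 2 * P.γ)))

/-- One sampling pass over all buckets in decreasing order, followed by pruning. -/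
def samplePass (P : Params V) (H : DAG V) (idx : V → ℕ) (R B : Finset V) :
    PMF (Finset V × Finset V) :=
  (sampleBuckets P H idx (Finset.univ.sup idx + 1) R B).bind fun r =>
    (prune P H r.2 r.1).bind fun R' => PMF.pure (R', r.2)

/-! Facts used for the termination of the two outer loops. -/

theorem sampleBucket_support (P : Params V) (H : DAG V) (idx : V → ℕ) (i : ℕ) :
    ∀ (n : ℕ) (R B : Finset V) (s : ℕ), R.card = n →
      ∀ r ∈ (sampleBucket P H idx i R B s).support, r.1 ⊆ R ∧ B ⊆ r.2 := by
  intro n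
  induction n with
  | zero =>
    intro R B s hR r hr
    rw [sampleBucket] at hr
    have hR' : R = ∅ := Finset.card_eq_zero.1 hR
    have hb : ¬ (s < P.N ∧ (bucket idx i R).Nonempty) := by
      subst hR'; simp [bucket]
    rw [dif_neg hb, PMF.support_pure, Set.mem_singleton_iff] at hr
    subst hr
    exact ⟨subset_rfl, subset_rfl⟩
  | succ n ih =>
    intro R B s hR r hr
    rw [sampleBucket] at hr
    split_ifs at hr with h
    · rw [PMF.mem_support_bindOnSupport_iff] at hr
      obtain ⟨v, hv, hr⟩ := hr
      have hvR : v ∈ R :=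
        (Finset.mem_filter.1 ((PMF.mem_support_uniformOfFinset_iff _ _).1 hv)).1
      have hc : (R.erase v).card = n := by rw [Finset.card_erase_of_mem hvR, hR]; rfl
      split_ifs at hr with hf
      · have := ih _ _ _ hc r hr
        exact ⟨this.1.trans (Finset.erase_subset _ _), (Finset.subset_insert _ _).trans this.2⟩
      · have := ih _ _ _ hc r hr
        exact ⟨this.1.trans (Finset.erase_subset _ _), this.2⟩
    · rw [PMF.support_pure, Set.mem_singleton_iff] at hr
      subst hr
      exact ⟨subset_rfl, subset_rfl⟩

theorem fresh_empty (P : Params V) (H : DAG V) {v : V} (hv : v ∈ H.verts) : Fresh P H ∅ v := by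
  have h0 : H.ancSet ∅ = ∅ := by simp [DAG.ancSet]
  have h1 : H.ancEdgesSet ∅ = ∅ := by simp [DAG.ancEdgesSet, DAG.inducedEdges, h0]
  have hγ : P.γ < 1 := P.γ_lt.trans (by norm_num)
  have hpos : (0 : ℝ) < (H.anc v).card := by
    exact_mod_cast Finset.card_pos.2 ⟨v, H.self_mem_anc hv⟩
  refine ⟨?_, ?_⟩
  · rw [h0, Finset.sdiff_empty]; nlinarith
  · rw [h1, Finset.sdiff_empty]
    rcases (H.ancEdges v).eq_empty_or_nonempty with he | he
    · exact Or.inl he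
    · right
      have : (0 : ℝ) < (H.ancEdges v).card := by exact_mod_cast Finset.card_pos.2 he
      nlinarith

theorem sampleBucket_progress (P : Params V) (H : DAG V) (idx : V → ℕ) (i : ℕ) (R B : Finset V)
    (hne : (bucket idx i R).Nonempty) :
    ∀ r ∈ (sampleBucket P H idx i R B 0).support,
      r.1 ⊂ R ∧ (R ⊆ H.verts → r.2.Nonempty) := by
  intro r hr
  rw [sampleBucket, dif_pos ⟨P.N_pos, hne⟩, PMF.mem_support_bindOnSupport_iff] at hr
  obtain ⟨v, hv, hr⟩ := hr
  have hvR : v ∈ R :=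
    (Finset.mem_filter.1 ((PMF.mem_support_uniformOfFinset_iff _ _).1 hv)).1
  split_ifs at hr with hf
  · have := sampleBucket_support P H idx i _ _ _ _ rfl r hr
    exact ⟨lt_of_le_of_lt this.1 (Finset.erase_ssubset hvR),
      fun _ => ⟨v, this.2 (Finset.mem_insert_self _ _)⟩⟩
  · have := sampleBucket_support P H idx i _ _ _ _ rfl r hr
    refine ⟨lt_of_le_of_lt this.1 (Finset.erase_ssubset hvR), fun hRV => ?_⟩
    rcases B.eq_empty_or_nonempty with hB | hB
    · subst hB
      exact absurd (fresh_empty P H (hRV hvR)) hf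
    · exact hB.mono this.2

theorem sampleBuckets_support (P : Params V) (H : DAG V) (idx : V → ℕ) :
    ∀ (j : ℕ) (R B : Finset V), ∀ r ∈ (sampleBuckets P H idx j R B).support,
      r.1 ⊆ R ∧ B ⊆ r.2 ∧ ((∃ v ∈ R, idx v < j) → r.1 ⊂ R ∧ (R ⊆ H.verts → r.2.Nonempty)) := by
  intro j
  induction j with
  | zero =>
    intro R B r hr
    rw [sampleBuckets, PMF.support_pure, Set.mem_singleton_iff] at hr
    subst hr
    exact ⟨subset_rfl, subset_rfl, fun ⟨v, _, h⟩ => absurd h (Nat.not_lt_zero _)⟩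
  | succ j ih =>
    intro R B r hr
    rw [sampleBuckets, PMF.mem_support_bind_iff] at hr
    obtain ⟨q, hq, hr⟩ := hr
    have h1 := sampleBucket_support P H idx j _ _ _ _ rfl q hq
    have h2 := ih _ _ r hr
    refine ⟨h2.1.trans h1.1, h1.2.trans h2.2.1, fun ⟨v, hv, hj⟩ => ?_⟩
    by_cases hne : (bucket idx j R).Nonempty
    · have h3 := sampleBucket_progress P H idx j R B hne q hq
      exact ⟨lt_of_le_of_lt h2.1 h3.1, fun hRV => (h3.2 hRV).mono h2.2.1⟩
    · have hvj : idx v ≠ j := fun hvj => hne ⟨v, Finset.mem_filter.2 ⟨hv, hvj⟩⟩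
      rw [sampleBucket, dif_neg (fun h => hne h.2), PMF.support_pure,
        Set.mem_singleton_iff] at hq
      subst hq
      exact h2.2.2 ⟨v, hv, by omega⟩

theorem samplePass_support (P : Params V) (H : DAG V) (idx : V → ℕ) (R B : Finset V)
    (hR : R.Nonempty) :
    ∀ r ∈ (samplePass P H idx R B).support,
      r.1 ⊂ R ∧ B ⊆ r.2 ∧ (R ⊆ H.verts → r.2.Nonempty) := by
  intro r hr
  simp only [samplePass, prune, PMF.mem_support_bind_iff, PMF.support_pure,
    Set.mem_singleton_iff] at hr
  obtain ⟨q, hq, R', ⟨e, -, e', -, hR'⟩, rfl⟩ := hr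
  obtain ⟨v, hv⟩ := hR
  have h := sampleBuckets_support P H idx _ R B q hq
  have h' := h.2.2 ⟨v, hv, Nat.lt_succ_of_le (Finset.le_sup (Finset.mem_univ v))⟩
  refine ⟨lt_of_le_of_lt ?_ h'.1, h.2.1, h'.2⟩
  rw [hR']
  exact Finset.filter_subset _ _

/-- Sampling and pruning, repeated until all buckets are empty. Returns the batch. -/
def batchLoop (P : Params V) (H : DAG V) (idx : V → ℕ) (R B : Finset V) : PMF (Finset V) :=
  if _h : R.Nonempty then
    (samplePass P H idx R B).bindOnSupport fun r _hr => batchLoop P H idx r.1 r.2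
  else PMF.pure B
termination_by R.card
decreasing_by exact Finset.card_lt_card (samplePass_support P H idx R B _h r _hr).1

/-- `FindBatch`: estimate, put all vertices into buckets according to the estimated number of
ancestor edges, and sample and prune until all buckets are empty. -/
def findBatch (P : Params V) (H : DAG V) : PMF (Finset V) :=
  (estimates P H).bind fun e => batchLoop P H (fun v => bucketIndex (e.2 v)) H.verts ∅

theorem batchLoop_support (P : Params V) (H : DAG V) (idx : V → ℕ) :
    ∀ (n : ℕ) (R B : Finset V), R.card = n →
      ∀ B' ∈ (batchLoop P H idx R B).support, B ⊆ B' ∧ (R.Nonempty → R ⊆ H.verts → B'.Nonempty) := by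
  intro n
  induction n using Nat.strong_induction_on with
  | _ n ih =>
    intro R B hR B' hB'
    rw [batchLoop] at hB'
    split_ifs at hB' with h
    · rw [PMF.mem_support_bindOnSupport_iff] at hB'
      obtain ⟨r, hr, hB'⟩ := hB'
      have h1 := samplePass_support P H idx R B h r hr
      have h2 := ih _ (hR ▸ Finset.card_lt_card h1.1) r.1 r.2 rfl B' hB'
      exact ⟨h1.2.1.trans h2.1, fun _ hRV => (h1.2.2 hRV).mono h2.1⟩
    · rw [PMF.support_pure, Set.mem_singleton_iff] at hB'
      subst hB'
      exact ⟨subset_rfl, fun h' => absurd h' h⟩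

/-- The vertices found by the algorithm stay within `H`. -/
theorem sampleBucket_subset (P : Params V) (H : DAG V) (idx : V → ℕ) (i : ℕ) :
    ∀ (n : ℕ) (R B : Finset V) (s : ℕ), R.card = n → R ⊆ H.verts → B ⊆ H.verts →
      ∀ r ∈ (sampleBucket P H idx i R B s).support, r.2 ⊆ H.verts := by
  intro n
  induction n using Nat.strong_induction_on with
  | _ n ih =>
    intro R B s hR hRV hBV r hr
    rw [sampleBucket] at hr
    split_ifs at hr with h
    · rw [PMF.mem_support_bindOnSupport_iff] at hr
      obtain ⟨v, hv, hr⟩ := hr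
      have hvR : v ∈ R :=
        (Finset.mem_filter.1 ((PMF.mem_support_uniformOfFinset_iff _ _).1 hv)).1
      have hc : (R.erase v).card < n := hR ▸ Finset.card_erase_lt_of_mem hvR
      have hs : R.erase v ⊆ H.verts := (Finset.erase_subset _ _).trans hRV
      split_ifs at hr with hf
      · exact ih _ hc _ _ _ rfl hs (Finset.insert_subset (hRV hvR) hBV) r hr
      · exact ih _ hc _ _ _ rfl hs hBV r hr
    · rw [PMF.support_pure, Set.mem_singleton_iff] at hr
      subst hr
      exact hBV

theorem sampleBuckets_subset (P : Params V) (H : DAG V) (idx : V → ℕ) :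
    ∀ (j : ℕ) (R B : Finset V), R ⊆ H.verts → B ⊆ H.verts →
      ∀ r ∈ (sampleBuckets P H idx j R B).support, r.2 ⊆ H.verts := by
  intro j
  induction j with
  | zero =>
    intro R B _ hB r hr
    rw [sampleBuckets, PMF.support_pure, Set.mem_singleton_iff] at hr
    subst hr
    exact hB
  | succ j ih =>
    intro R B hR hB r hr
    rw [sampleBuckets, PMF.mem_support_bind_iff] at hr
    obtain ⟨q, hq, hr⟩ := hr
    exact ih _ _ ((sampleBucket_support P H idx j _ _ _ _ rfl q hq).1.trans hR)
      (sampleBucket_subset P H idx j _ _ _ _ rfl hR hB q hq) r hr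

theorem batchLoop_subset (P : Params V) (H : DAG V) (idx : V → ℕ) :
    ∀ (n : ℕ) (R B : Finset V), R.card = n → R ⊆ H.verts → B ⊆ H.verts →
      ∀ B' ∈ (batchLoop P H idx R B).support, B' ⊆ H.verts := by
  intro n
  induction n using Nat.strong_induction_on with
  | _ n ih =>
    intro R B hR hRV hBV B' hB'
    rw [batchLoop] at hB'
    split_ifs at hB' with h
    · rw [PMF.mem_support_bindOnSupport_iff] at hB'
      obtain ⟨r, hr, hB'⟩ := hB'
      have h1 := (samplePass_support P H idx R B h r hr).1
      have h3 : r.2 ⊆ H.verts := by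
        simp only [samplePass, PMF.mem_support_bind_iff, PMF.support_pure,
          Set.mem_singleton_iff] at hr
        obtain ⟨q, hq, R', -, rfl⟩ := hr
        exact sampleBuckets_subset P H idx _ R B hRV hBV q hq
      exact ih _ (hR ▸ Finset.card_lt_card h1) r.1 r.2 rfl (h1.1.trans hRV) h3 B' hB'
    · rw [PMF.support_pure, Set.mem_singleton_iff] at hB'
      subst hB'
      exact hBV

theorem findBatch_progress (P : Params V) (H : DAG V) (hH : H.verts.Nonempty) :
    ∀ B ∈ (findBatch P H).support, (H.remove (H.ancSet B)).verts.card < H.verts.card := by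
  intro B hB
  rw [findBatch, PMF.mem_support_bind_iff] at hB
  obtain ⟨e, -, hB⟩ := hB
  obtain ⟨v, hv⟩ := (batchLoop_support P H _ _ _ _ rfl B hB).2 hH subset_rfl
  have hvH : v ∈ H.verts :=
    batchLoop_subset P H _ _ _ _ rfl subset_rfl (Finset.empty_subset _) B hB hv
  have hvA : v ∈ H.ancSet B := Finset.mem_biUnion.2 ⟨v, hv, H.self_mem_anc hvH⟩
  exact Finset.card_lt_card (Finset.ssubset_iff_subset_ne.2
    ⟨Finset.sdiff_subset, fun h => (Finset.mem_sdiff.1 (h ▸ hvH)).2 hvA⟩)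

/-- `ScheduleSmallSubgraph`: as long as vertices of `H` are left, find a batch `B`, schedule the
ancestor sets of its elements, and remove all scheduled vertices (the ancestors of `B`) from `H`.
The result is the random sequence of batches. The placement of a batch on the machines and the
communication delay after it have no influence on this sequence. -/
def scheduleSmallSubgraph (P : Params V) (H : DAG V) : PMF (List (Finset V)) :=
  if _h : H.verts.Nonempty then
    (findBatch P H).bindOnSupport fun B _hB =>
      (scheduleSmallSubgraph P (H.remove (H.ancSet B))).bind fun L => PMF.pure (B :: L)
  else PMF.pure []
termination_by H.verts.card
decreasing_by exact findBatch_progress P H _h B _hB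

end

end BatchScheduling

/-!
For a hash function drawn from the family, the number of elements of `S` whose hash value is at
most `q` has mean `|S| q / M` and, by pairwise independence, at most that variance. Chebyshev's
inequality at the two thresholds `q` that correspond to the estimates `(1 ± ε) |S|`, together with
the rarity of collisions among the `u ^ 3` hash values, shows that a single estimate is accurate
with probability well above `1 / 2`, and the median makes the error probability exponentially small
in `k`. There are at most `n ^ 2` pruning steps, each of which needs two estimates per vertex in two
graphs, so by a union bound all estimates used for pruning are accurate with high probability.

If they are, then each batch leaves at most a `4γ`-fraction of the ancestors, or of the ancestor
edges, of every vertex: a stale vertex even loses all but a `γ`-fraction, and a pruned one has a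
ratio of estimates of at most `2γ`, each estimate being off by a factor between `2 / 3` and `4 / 3`.

Let `v` have `a` ancestors, hence at most `a ^ 2 / 2` ancestor edges, and let it be scheduled in the
batch `T ≥ 4`. A vertex without ancestor edges is its own only ancestor and does not survive a
reduction, so `v` has an ancestor edge after `T - 2` batches. If `i` of these reduced the ancestors
of `v` and `j` the edges, then `2 ≤ (4γ) ^ i * a` and `1 ≤ (4γ) ^ j * a ^ 2`. For `2 ≤ i` the
product of these bounds with `1 ≤ (4γ) ^ 2 * a` is `1 ≤ (4γ) ^ T * a ^ 4`, that is,
`T ≤ 4 log_{1/(4γ)} a`. For `i ≤ 1` almost all reductions are of edges, and the first few batches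
make up for the rest: surviving three of them forces `2 ≤ (4γ) ^ 2 * a ^ 2`, and surviving four
forces `2 ≤ (4γ) ^ 3 * a ^ 2`.
-/

namespace BatchScheduling

open scoped Classical ENNReal
open MeasureTheory ProbabilityTheory

noncomputable section

section FailProb

variable {α β : Type*}

/-- The probability that the outcome of `p` does not satisfy `Q`. -/
def failProb (p : PMF α) (Q : α → Prop) : ℝ≥0∞ := p.toOuterMeasure {a | ¬ Q a}

theorem failProb_le_one (p : PMF α) (Q : α → Prop) : failProb p Q ≤ 1 := by
  rw [failProb, ← (p.toOuterMeasure_apply_eq_one_iff (s := Set.univ)).2 (Set.subset_univ _)]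
  exact p.toOuterMeasure.mono (Set.subset_univ _)

theorem failProb_eq_zero {p : PMF α} {Q : α → Prop} (h : ∀ a ∈ p.support, Q a) :
    failProb p Q = 0 := by
  rw [failProb, PMF.toOuterMeasure_apply_eq_zero_iff, Set.disjoint_left]
  exact fun a ha hQ => hQ (h a ha)

theorem failProb_mono {p : PMF α} {Q R : α → Prop} (h : ∀ a, Q a → R a) :
    failProb p R ≤ failProb p Q :=
  p.toOuterMeasure.mono fun a ha hQ => ha (h a hQ)

theorem failProb_pure {a : α} {Q : α → Prop} (h : Q a) : failProb (PMF.pure a) Q = 0 :=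
  failProb_eq_zero fun b hb => by rwa [(PMF.mem_support_pure_iff a b).1 hb]

theorem failProb_bindOnSupport_le {p : PMF α} {f : ∀ a ∈ p.support, PMF β} {Q : α → Prop}
    {R : β → Prop} {ε₁ ε₂ : ℝ≥0∞} (h₁ : failProb p Q ≤ ε₁)
    (h₂ : ∀ a (h : a ∈ p.support), Q a → failProb (f a h) R ≤ ε₂) :
    failProb (p.bindOnSupport f) R ≤ ε₁ + ε₂ := by
  rw [failProb, PMF.toOuterMeasure_bindOnSupport_apply]
  calc _ ≤ ∑' a, ({a | ¬ Q a}.indicator p a + p a * ε₂) := by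
        refine ENNReal.tsum_le_tsum fun a => ?_
        split_ifs with h0
        · simp
        · by_cases hQ : Q a
          · exact le_add_left (mul_le_mul_right (h₂ a h0 hQ) _)
          · rw [Set.indicator_of_mem (by exact hQ)]
            exact le_add_right (mul_le_of_le_one_right' (failProb_le_one _ R))
    _ = failProb p Q + ε₂ := by
        rw [ENNReal.tsum_add, ENNReal.tsum_mul_right, p.tsum_coe, one_mul, failProb,
          PMF.toOuterMeasure_apply]
    _ ≤ ε₁ + ε₂ := add_le_add_left h₁ _

theorem failProb_bind_le {p : PMF α} {f : α → PMF β} {Q : α → Prop} {R : β → Prop}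
    {ε₁ ε₂ : ℝ≥0∞} (h₁ : failProb p Q ≤ ε₁)
    (h₂ : ∀ a ∈ p.support, Q a → failProb (f a) R ≤ ε₂) :
    failProb (p.bind f) R ≤ ε₁ + ε₂ := by
  rw [← PMF.bindOnSupport_eq_bind]
  exact failProb_bindOnSupport_le h₁ h₂

theorem failProb_forall_le {ι : Type*} [Fintype ι] {p : PMF α} {Q : ι → α → Prop} {ε : ℝ≥0∞}
    (h : ∀ i, failProb p (Q i) ≤ ε) :
    failProb p (fun a => ∀ i, Q i a) ≤ Fintype.card ι * ε := by
  have hunion : {a | ¬ ∀ i, Q i a} = ⋃ i, {a | ¬ Q i a} := by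
    ext a
    simp
  calc failProb p (fun a => ∀ i, Q i a) ≤ ∑ i, failProb p (Q i) := by
        rw [failProb, hunion]
        exact measure_iUnion_fintype_le p.toOuterMeasure _
    _ ≤ ∑ _i : ι, ε := Finset.sum_le_sum fun i _ => h i
    _ = Fintype.card ι * ε := by rw [Finset.sum_const, nsmul_eq_mul, Finset.card_univ]

theorem failProb_uniformOfFintype_le_ofReal_iff [Fintype α] [Nonempty α] {Q : α → Prop}
    [DecidablePred Q] {δ : ℝ} (hδ : 0 ≤ δ) :
    failProb (PMF.uniformOfFintype α) Q ≤ ENNReal.ofReal δ ↔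
      ((Finset.univ.filter fun a => ¬ Q a).card : ℝ) ≤ δ * Fintype.card α := by
  have hα : (0 : ℝ) < Fintype.card α := Nat.cast_pos.2 Fintype.card_pos
  have hcard : failProb (PMF.uniformOfFintype α) Q =
      ENNReal.ofReal ((Finset.univ.filter fun a => ¬ Q a).card / Fintype.card α) := by
    rw [failProb, PMF.toOuterMeasure_uniformOfFintype_apply, ENNReal.ofReal_div_of_pos hα,
      ENNReal.ofReal_natCast, ENNReal.ofReal_natCast, ← Fintype.card_subtype]
    rfl
  rw [hcard, ENNReal.ofReal_le_ofReal_iff hδ, div_le_iff₀ hα]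

theorem failProb_eq_ofReal_real {_ : MeasurableSpace α} [MeasurableSingletonClass α] (p : PMF α)
    (Q : α → Prop) : failProb p Q = ENNReal.ofReal (p.toMeasure.real {a | ¬ Q a}) := by
  rw [failProb, ofReal_measureReal, PMF.toMeasure_apply_eq_toOuterMeasure]

theorem one_sub_le_toReal_of_failProb_le {p : PMF α} {Q : α → Prop} {δ : ℝ} (hδ : 0 ≤ δ)
    (h : failProb p Q ≤ ENNReal.ofReal δ) : 1 - δ ≤ (p.toOuterMeasure {a | Q a}).toReal := by
  rw [sub_le_iff_le_add, ← ENNReal.ofReal_le_ofReal_iff (by positivity), ENNReal.ofReal_one,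
    ENNReal.ofReal_add ENNReal.toReal_nonneg hδ, ENNReal.ofReal_toReal]
  · calc 1 = p.toOuterMeasure Set.univ :=
          ((p.toOuterMeasure_apply_eq_one_iff _).2 (Set.subset_univ _)).symm
      _ ≤ p.toOuterMeasure {a | Q a} + failProb p Q := by
          rw [← Set.union_compl_self {a | Q a}]
          exact measure_union_le _ _
      _ ≤ p.toOuterMeasure {a | Q a} + ENNReal.ofReal δ := add_le_add_right h _
  · have hle := failProb_le_one p fun a => ¬ Q a
    simp only [failProb, not_not] at hle
    exact ne_top_of_le_ne_top ENNReal.one_ne_top hle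

end FailProb

section HitCount

variable {U : Type*} {M : ℕ}

/-- The number of elements of `S` whose hash value, counted from `1`, is at most `q`. -/
def hitCount (h : U → Fin M) (S : Finset U) (q : ℕ) : ℕ :=
  (S.filter fun x => (h x : ℕ) + 1 ≤ q).card

namespace HashFamily

instance (F : HashFamily U M) : MeasurableSpace F.Seed := ⊤

instance (F : HashFamily U M) : DiscreteMeasurableSpace F.Seed := ⟨fun _ => trivial⟩

/-- The uniform distribution on the seeds, as a measure, so that the independence and variance
lemmas for random variables apply to hash values. -/
def seedMeasure (F : HashFamily U M) : Measure F.Seed := (PMF.uniformOfFintype F.Seed).toMeasure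

instance (F : HashFamily U M) : IsProbabilityMeasure F.seedMeasure :=
  PMF.toMeasure.isProbabilityMeasure _

variable (F : HashFamily U M)

theorem seedMeasure_real_setOf (p : F.Seed → Prop) [DecidablePred p] :
    F.seedMeasure.real {s | p s} = (Finset.univ.filter p).card / Fintype.card F.Seed := by
  rw [measureReal_def, seedMeasure, PMF.toMeasure_uniformOfFintype_apply,
    ENNReal.toReal_div, ENNReal.toReal_natCast, ENNReal.toReal_natCast, ← Fintype.card_subtype]
  · rfl
  · exact .of_discrete

theorem seedMeasure_real_pair {x y : U} (hxy : x ≠ y) (a b : Fin M) :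
    F.seedMeasure.real {s | F.hash s x = a ∧ F.hash s y = b} = (M : ℝ)⁻¹ * (M : ℝ)⁻¹ := by
  have hM : (M : ℝ) ≠ 0 := Nat.cast_ne_zero.2 a.pos.ne'
  have hSeed : (Fintype.card F.Seed : ℝ) ≠ 0 := Nat.cast_ne_zero.2 Fintype.card_ne_zero
  have h := congrArg (Nat.cast (R := ℝ)) (F.two_universal x y hxy a b)
  push_cast at h
  rw [seedMeasure_real_setOf]
  field_simp
  exact h

theorem seedMeasure_real_single [Nontrivial U] (x : U) (a : Fin M) :
    F.seedMeasure.real {s | F.hash s x = a} = (M : ℝ)⁻¹ := by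
  obtain ⟨y, hyx⟩ := exists_ne x
  have hM : (M : ℝ) ≠ 0 := Nat.cast_ne_zero.2 a.pos.ne'
  calc F.seedMeasure.real {s | F.hash s x = a}
      = ∑ b, F.seedMeasure.real {s | F.hash s x = a ∧ F.hash s y = b} := by
        rw [← measureReal_biUnion_finset]
        · congr 1
          ext s
          simp
        · intro b _ c _ hbc
          exact Set.disjoint_left.2 fun s hb hc => hbc (hb.2.symm.trans hc.2)
        · exact fun b _ => .of_discrete
    _ = (M : ℝ)⁻¹ := by
        simp only [F.seedMeasure_real_pair hyx.symm, Finset.sum_const, Finset.card_univ,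
          Fintype.card_fin, nsmul_eq_mul]
        field_simp

theorem indepFun_hash [Nontrivial U] {x y : U} (hxy : x ≠ y) :
    IndepFun (F.hash · x) (F.hash · y) F.seedMeasure := by
  rw [indepFun_iff_map_prod_eq_prod_map_map (Measurable.of_discrete).aemeasurable
    (Measurable.of_discrete).aemeasurable]
  refine Measure.ext_of_singleton fun p => (measureReal_eq_measureReal_iff).1 ?_
  rw [← Prod.mk.eta (p := p), ← Set.singleton_prod_singleton, measureReal_prod_prod,
    map_measureReal_apply .of_discrete .of_discrete,
    map_measureReal_apply .of_discrete .of_discrete,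
    map_measureReal_apply .of_discrete .of_discrete]
  exact (F.seedMeasure_real_pair hxy p.1 p.2).trans
    (congrArg₂ _ (F.seedMeasure_real_single x p.1) (F.seedMeasure_real_single y p.2)).symm

theorem seedMeasure_real_hash_le [Nontrivial U] (x : U) {q : ℕ} (hq : q ≤ M) :
    F.seedMeasure.real {s | (F.hash s x : ℕ) + 1 ≤ q} = q / M := by
  have hcard : (Finset.univ.filter fun a : Fin M => (a : ℕ) + 1 ≤ q).card = q := by
    simp only [Nat.add_one_le_iff, Fin.card_filter_val_lt, min_eq_right hq]
  calc F.seedMeasure.real {s | (F.hash s x : ℕ) + 1 ≤ q}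
      = F.seedMeasure.real
          ((F.hash · x) ⁻¹' (Finset.univ.filter fun a : Fin M => (a : ℕ) + 1 ≤ q)) := by
        congr 1
        ext s
        simp
    _ = ∑ a ∈ Finset.univ.filter fun a : Fin M => (a : ℕ) + 1 ≤ q,
          F.seedMeasure.real {s | F.hash s x = a} :=
        (sum_measureReal_preimage_singleton (μ := F.seedMeasure) _ fun _ _ => .of_discrete).symm
    _ = q / M := by
        simp only [F.seedMeasure_real_single, Finset.sum_const, hcard, nsmul_eq_mul,
          div_eq_mul_inv]

/-- The indicator of the event that the hash value of `x`, counted from `1`, is at most `q`, as a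
random variable on the seeds. -/
def hitIndicator (x : U) (q : ℕ) : F.Seed → ℝ := {s | (F.hash s x : ℕ) + 1 ≤ q}.indicator 1

theorem hitCount_eq_sum_hitIndicator (S : Finset U) (q : ℕ) (s : F.Seed) :
    (hitCount (F.hash s) S q : ℝ) = ∑ x ∈ S, F.hitIndicator x q s := by
  rw [hitCount, Finset.card_filter]
  simp [hitIndicator, Set.indicator_apply]

theorem integral_hitIndicator [Nontrivial U] (x : U) {q : ℕ} (hq : q ≤ M) :
    ∫ s, F.hitIndicator x q s ∂F.seedMeasure = q / M := by
  rw [hitIndicator, integral_indicator_one .of_discrete, F.seedMeasure_real_hash_le x hq]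

theorem integral_hitCount [Nontrivial U] (S : Finset U) {q : ℕ} (hq : q ≤ M) :
    ∫ s, (hitCount (F.hash s) S q : ℝ) ∂F.seedMeasure = S.card * q / M := by
  simp only [hitCount_eq_sum_hitIndicator]
  rw [integral_finsetSum _ fun x _ => .of_finite]
  simp only [F.integral_hitIndicator _ hq, Finset.sum_const, nsmul_eq_mul, mul_div_assoc]

theorem variance_hitIndicator_le [Nontrivial U] (x : U) {q : ℕ} (hq : q ≤ M) :
    Var[F.hitIndicator x q; F.seedMeasure] ≤ q / M := by
  refine (variance_le_expectation_sq Measurable.of_discrete.aestronglyMeasurable).trans_eq ?_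
  rw [← F.integral_hitIndicator x hq]
  congr 1
  ext s
  simp [hitIndicator, Set.indicator_apply]

theorem variance_hitCount_le [Nontrivial U] (S : Finset U) {q : ℕ} (hq : q ≤ M) :
    Var[fun s => (hitCount (F.hash s) S q : ℝ); F.seedMeasure] ≤ S.card * q / M := by
  have hind : ∀ x y, x ≠ y →
      IndepFun (F.hitIndicator x q) (F.hitIndicator y q) F.seedMeasure := fun x y hxy =>
    (F.indepFun_hash hxy).comp (φ := {a : Fin M | (a : ℕ) + 1 ≤ q}.indicator 1)
      (ψ := {a : Fin M | (a : ℕ) + 1 ≤ q}.indicator 1) .of_discrete .of_discrete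
  simp only [hitCount_eq_sum_hitIndicator]
  calc Var[fun s => ∑ x ∈ S, F.hitIndicator x q s; F.seedMeasure]
      = ∑ x ∈ S, Var[F.hitIndicator x q; F.seedMeasure] := by
        rw [← IndepFun.variance_sum (fun x _ => .of_discrete) fun x _ y _ hxy => hind x y hxy]
        congr 1
        ext s
        simp
    _ ≤ ∑ _x ∈ S, (q / M : ℝ) := Finset.sum_le_sum fun x _ => F.variance_hitIndicator_le x hq
    _ = S.card * q / M := by rw [Finset.sum_const, nsmul_eq_mul, mul_div_assoc]

theorem seedMeasure_real_deviation_le [Nontrivial U] (S : Finset U) {q : ℕ} (hq : q ≤ M) {r : ℝ}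
    (hr : 0 < r) :
    F.seedMeasure.real {s | r ≤ |(hitCount (F.hash s) S q : ℝ) - S.card * q / M|} ≤
      S.card * q / M / r ^ 2 := by
  have hcheb := meas_ge_le_variance_div_sq (μ := F.seedMeasure)
    (X := fun s => (hitCount (F.hash s) S q : ℝ)) .of_discrete hr
  rw [F.integral_hitCount S hq] at hcheb
  refine (ENNReal.toReal_le_of_le_ofReal
    (div_nonneg (variance_nonneg _ _) (sq_nonneg r)) hcheb).trans ?_
  gcongr
  exact F.variance_hitCount_le S hq

theorem seedMeasure_real_collision {x y : U} (hxy : x ≠ y) :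
    F.seedMeasure.real {s | F.hash s x = F.hash s y} = (M : ℝ)⁻¹ := by
  calc F.seedMeasure.real {s | F.hash s x = F.hash s y}
      = ∑ a, F.seedMeasure.real {s | F.hash s x = a ∧ F.hash s y = a} := by
        rw [← measureReal_biUnion_finset]
        · congr 1
          ext s
          simp [eq_comm]
        · intro a _ b _ hab
          exact Set.disjoint_left.2 fun s ha hb => hab (ha.1.symm.trans hb.1)
        · exact fun a _ => .of_discrete
    _ = (M : ℝ)⁻¹ := by
        simp only [F.seedMeasure_real_pair hxy, Finset.sum_const, Finset.card_univ,
          Fintype.card_fin, nsmul_eq_mul]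
        field_simp

theorem seedMeasure_real_not_injOn_le (S : Finset U) :
    F.seedMeasure.real {s | ¬ Set.InjOn (F.hash s) S} ≤ S.card * (S.card - 1) / M := by
  calc F.seedMeasure.real {s | ¬ Set.InjOn (F.hash s) S}
      ≤ F.seedMeasure.real (⋃ p ∈ S.offDiag, {s | F.hash s p.1 = F.hash s p.2}) := by
        refine measureReal_mono (fun s (hs : ¬ Set.InjOn (F.hash s) S) => ?_) (measure_ne_top _ _)
        rw [Set.InjOn] at hs
        push Not at hs
        obtain ⟨x, hx, y, hy, hhash, hxy⟩ := hs
        exact Set.mem_biUnion (x := (x, y)) (Finset.mem_offDiag.2 ⟨hx, hy, hxy⟩) hhash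
    _ ≤ ∑ p ∈ S.offDiag, F.seedMeasure.real {s | F.hash s p.1 = F.hash s p.2} :=
        measureReal_biUnion_finset_le _ _
    _ = ∑ _p ∈ S.offDiag, (M : ℝ)⁻¹ :=
        Finset.sum_congr rfl fun p hp => F.seedMeasure_real_collision (Finset.mem_offDiag.1 hp).2.2
    _ = S.card * (S.card - 1) / M := by
        rw [Finset.sum_const, Finset.offDiag_card, nsmul_eq_mul, Nat.cast_sub (Nat.le_mul_self _),
          div_eq_mul_inv]
        push_cast
        ring

end HashFamily

end HitCount

section SingleEstimate

variable {U : Type*} {M : ℕ}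

theorem orderEmbOfFin_le_iff_lt_card_filter {α : Type*} [LinearOrder α] (s : Finset α) {k : ℕ}
    (hk : s.card = k) (i : Fin k) (q : α) :
    s.orderEmbOfFin hk i ≤ q ↔ i < (s.filter (· ≤ q)).card := by
  constructor
  · intro hi
    have hsub : (Finset.Iic i).map (s.orderEmbOfFin hk).toEmbedding ⊆ s.filter (· ≤ q) := by
      intro y hy
      obtain ⟨j, hj, rfl⟩ := Finset.mem_map.1 hy
      exact Finset.mem_filter.2 ⟨s.orderEmbOfFin_mem hk j,
        ((s.orderEmbOfFin hk).monotone (Finset.mem_Iic.1 hj)).trans hi⟩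
    simpa using Finset.card_le_card hsub
  · contrapose!
    intro hi
    have hsub : s.filter (· ≤ q) ⊆ (Finset.Iio i).map (s.orderEmbOfFin hk).toEmbedding := by
      intro y hy
      obtain ⟨hys, hyq⟩ := Finset.mem_filter.1 hy
      obtain ⟨j, rfl⟩ : y ∈ Set.range (s.orderEmbOfFin hk) := by
        rwa [Finset.range_orderEmbOfFin]
      exact Finset.mem_map_of_mem _
        (Finset.mem_Iio.2 ((s.orderEmbOfFin hk).lt_iff_lt.1 (hyq.trans_lt hi)))
    simpa using Finset.card_le_card hsub

/-- The hash values, counted from `1`, of the elements of `S`. -/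
def hashValues (h : U → Fin M) (S : Finset U) : Finset ℕ := S.image fun x => (h x : ℕ) + 1

theorem card_hashValues_le (h : U → Fin M) (S : Finset U) : (hashValues h S).card ≤ S.card :=
  Finset.card_image_le

theorem hashValues_filter_le (h : U → Fin M) (S : Finset U) (q : ℕ) :
    (hashValues h S).filter (· ≤ q) = hashValues h (S.filter fun x => (h x : ℕ) + 1 ≤ q) :=
  Finset.filter_image

theorem card_hashValues_filter_le (h : U → Fin M) (S : Finset U) (q : ℕ) :
    ((hashValues h S).filter (· ≤ q)).card ≤ hitCount h S q := by
  rw [hashValues_filter_le]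
  exact card_hashValues_le _ _

theorem card_hashValues_of_injOn {h : U → Fin M} {S : Finset U} (hS : Set.InjOn h S) :
    (hashValues h S).card = S.card :=
  Finset.card_image_of_injOn fun _ hx _ hy hxy => hS hx hy (Fin.ext (Nat.succ_injective hxy))

theorem card_hashValues_filter_of_injOn {h : U → Fin M} {S : Finset U} (hS : Set.InjOn h S)
    (q : ℕ) : ((hashValues h S).filter (· ≤ q)).card = hitCount h S q := by
  rw [hashValues_filter_le]
  exact card_hashValues_of_injOn (hS.mono (Finset.filter_subset _ _))

theorem length_smallestValues (t : ℕ) (h : U → Fin M) (S : Finset U) :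
    (smallestValues t h S).length = min t (hashValues h S).card := by
  rw [smallestValues, List.length_take, Finset.length_sort, hashValues]

theorem singleEstimate_of_lt {t : ℕ} {h : U → Fin M} {S : Finset U}
    (hS : (hashValues h S).card < t) : singleEstimate t h S = (hashValues h S).card := by
  rw [singleEstimate, length_smallestValues, min_eq_right hS.le, if_pos hS]

theorem exists_singleEstimate_eq_div {t : ℕ} (ht : 0 < t) {h : U → Fin M} {S : Finset U}
    (hS : t ≤ (hashValues h S).card) :
    ∃ l ∈ hashValues h S, singleEstimate t h S = t * M / l ∧
      ∀ q, l ≤ q ↔ t ≤ ((hashValues h S).filter (· ≤ q)).card := by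
  have hlast : (smallestValues t h S).getLastD 1 =
      (hashValues h S).orderEmbOfFin rfl ⟨t - 1, by omega⟩ := by
    have hlen : (smallestValues t h S).length = t := by
      rw [length_smallestValues, min_eq_left hS]
    have hne : smallestValues t h S ≠ [] := List.ne_nil_of_length_pos (by omega)
    rw [List.getLastD_eq_getLast?, List.getLast?_eq_some_getLast hne, Option.getD_some,
      List.getLast_eq_getElem, Finset.orderEmbOfFin_apply]
    simp only [hlen]
    simp only [smallestValues, List.getElem_take, hashValues, Fin.getElem_fin]
  refine ⟨_, (hashValues h S).orderEmbOfFin_mem rfl ⟨t - 1, by omega⟩, ?_, fun q => ?_⟩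
  · rw [singleEstimate, length_smallestValues, min_eq_left hS, if_neg (lt_irrefl t), hlast]
  · rw [orderEmbOfFin_le_iff_lt_card_filter]
    simp only
    omega

theorem mem_hashValues_bounds {h : U → Fin M} {S : Finset U} {y : ℕ} (hy : y ∈ hashValues h S) :
    0 < y ∧ y ≤ M := by
  obtain ⟨x, -, rfl⟩ := Finset.mem_image.1 hy
  exact ⟨Nat.succ_pos _, (h x).2⟩

theorem le_hitCount_of_lt_singleEstimate {t : ℕ} (ht : 0 < t) {h : U → Fin M} {S : Finset U}
    {x : ℝ} (hx : S.card ≤ x) (hest : x < singleEstimate t h S) :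
    t ≤ S.card ∧ t ≤ hitCount h S ⌊t * M / x⌋₊ := by
  rcases lt_or_ge (hashValues h S).card t with hlt | hle
  · rw [singleEstimate_of_lt hlt] at hest
    exact absurd (hx.trans_lt hest) (by exact_mod_cast (card_hashValues_le h S).not_gt)
  · have htS : t ≤ S.card := hle.trans (card_hashValues_le h S)
    obtain ⟨l, hl, hest_eq, hl_le⟩ := exists_singleEstimate_eq_div ht hle
    have hl0 : (0 : ℝ) < l := Nat.cast_pos.2 (mem_hashValues_bounds hl).1
    have hx0 : 0 < x := (Nat.cast_pos.2 (ht.trans_le htS)).trans_le hx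
    rw [hest_eq, lt_div_iff₀ hl0] at hest
    have hlq : l ≤ ⌊t * M / x⌋₊ := Nat.le_floor ((le_div_iff₀ hx0).2 (by linarith))
    exact ⟨htS, ((hl_le _).1 hlq).trans (card_hashValues_filter_le h S _)⟩

theorem hitCount_lt_of_singleEstimate_lt {t : ℕ} (ht : 0 < t) {h : U → Fin M} {S : Finset U}
    (hinj : Set.InjOn h S) {x : ℝ} (hx : x ≤ S.card) (hest : singleEstimate t h S < x) :
    t ≤ S.card ∧ ⌊t * M / x⌋₊ ≤ M ∧ hitCount h S ⌊t * M / x⌋₊ < t := by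
  rcases lt_or_ge (hashValues h S).card t with hlt | hle
  · rw [singleEstimate_of_lt hlt, card_hashValues_of_injOn hinj] at hest
    exact absurd hx hest.not_ge
  · obtain ⟨l, hl, hest_eq, hl_le⟩ := exists_singleEstimate_eq_div ht hle
    have hl0 : (0 : ℝ) < l := Nat.cast_pos.2 (mem_hashValues_bounds hl).1
    have hx0 : 0 < x := lt_of_le_of_lt (by rw [hest_eq]; positivity) hest
    rw [hest_eq, div_lt_iff₀ hl0] at hest
    have hql : ⌊t * M / x⌋₊ < l := by
      rw [Nat.floor_lt (by positivity), div_lt_iff₀ hx0]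
      linarith
    refine ⟨hle.trans (card_hashValues_le h S), hql.le.trans (mem_hashValues_bounds hl).2, ?_⟩
    rw [← card_hashValues_filter_of_injOn hinj]
    exact not_le.1 fun hle => hql.not_ge ((hl_le _).2 hle)

theorem mul_floor_div_le {m : ℕ} (hm : 0 < m) (hM : 0 < M) (t : ℕ) {a : ℝ} (ha : 0 < a) :
    (m : ℝ) * ⌊t * M / (a * m)⌋₊ / M ≤ t / a := by
  have hM' : (0 : ℝ) < M := Nat.cast_pos.2 hM
  have hfloor : (⌊t * M / (a * m)⌋₊ : ℝ) * (a * m) ≤ t * M :=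
    (le_div_iff₀ (mul_pos ha (Nat.cast_pos.2 hm))).1 (Nat.floor_le (by positivity))
  rw [div_le_div_iff₀ hM' ha]
  linarith

theorem sub_one_le_mul_floor_div {m : ℕ} (hm : 0 < m) (hmM : m ≤ M) (t : ℕ) {a : ℝ}
    (ha : 0 < a) : t / a - 1 ≤ (m : ℝ) * ⌊t * M / (a * m)⌋₊ / M := by
  have hm' : (0 : ℝ) < m := Nat.cast_pos.2 hm
  have hmM' : (m : ℝ) ≤ M := Nat.cast_le.2 hmM
  have hM' : (0 : ℝ) < M := hm'.trans_le hmM'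
  have hfloor : t * M < ((⌊t * M / (a * m)⌋₊ : ℝ) + 1) * (a * m) :=
    (div_lt_iff₀ (by positivity)).1 (Nat.lt_floor_add_one _)
  rw [sub_le_iff_le_add, div_add_one hM'.ne', div_le_div_iff₀ ha hM']
  nlinarith

/-- The number `x` estimates `m` up to the relative error `ε`. -/
def Accurate (ε : ℝ) (m : ℕ) (x : ℝ) : Prop := x ∈ Set.Icc ((1 - ε) * m) ((1 + ε) * m)

namespace HashFamily

theorem pos [Nonempty U] (F : HashFamily U M) : 0 < M :=
  (F.hash (Classical.arbitrary F.Seed) (Classical.arbitrary U)).pos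

variable (F : HashFamily U M)

theorem seedMeasure_real_lt_singleEstimate_le [Nontrivial U] {ε : ℝ} (hε : 0 < ε) {t : ℕ}
    (ht : 0 < t) (S : Finset U) :
    F.seedMeasure.real {s | (1 + ε) * S.card < singleEstimate t (F.hash s) S} ≤
      (1 + ε) / (t * ε ^ 2) := by
  have hover : ∀ s, (1 + ε) * S.card < singleEstimate t (F.hash s) S →
      t ≤ S.card ∧ t ≤ hitCount (F.hash s) S ⌊t * M / ((1 + ε) * S.card)⌋₊ := fun s hs =>
    le_hitCount_of_lt_singleEstimate ht (le_mul_of_one_le_left (by positivity) (by linarith)) hs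
  rcases lt_or_ge S.card t with hlt | hle
  · have hempty : {s | (1 + ε) * S.card < singleEstimate t (F.hash s) S} = ∅ :=
      Set.eq_empty_of_forall_notMem fun s hs => hlt.not_ge (hover s hs).1
    rw [hempty, measureReal_empty]
    positivity
  set q := ⌊t * M / ((1 + ε) * S.card)⌋₊
  have ht0 : (0 : ℝ) < t := Nat.cast_pos.2 ht
  have hS0 : (0 : ℝ) < S.card := Nat.cast_pos.2 (ht.trans_le hle)
  have hqM : q ≤ M := by
    refine Nat.floor_le_of_le ((div_le_iff₀ (by positivity)).2 ?_)
    have htS : (t : ℝ) ≤ (1 + ε) * S.card :=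
      (Nat.cast_le.2 hle).trans (le_mul_of_one_le_left hS0.le (by linarith))
    rw [mul_comm]
    gcongr
  have hmean : (S.card * q / M : ℝ) ≤ t / (1 + ε) :=
    mul_floor_div_le (ht.trans_le hle) F.pos t (by positivity)
  have hdev : t * ε / (1 + ε) = t - t / (1 + ε) := by field_simp; ring
  calc F.seedMeasure.real {s | (1 + ε) * S.card < singleEstimate t (F.hash s) S}
      ≤ F.seedMeasure.real
          {s | t * ε / (1 + ε) ≤ |(hitCount (F.hash s) S q : ℝ) - S.card * q / M|} := by
        refine measureReal_mono (fun s hs => ?_) (measure_ne_top _ _)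
        have hhit : (t : ℝ) ≤ hitCount (F.hash s) S q := Nat.cast_le.2 (hover s hs).2
        have hlower : t * ε / (1 + ε) ≤ hitCount (F.hash s) S q - S.card * q / M := by linarith
        exact hlower.trans (le_abs_self _)
    _ ≤ S.card * q / M / (t * ε / (1 + ε)) ^ 2 :=
        F.seedMeasure_real_deviation_le S hqM (by positivity)
    _ ≤ t / (1 + ε) / (t * ε / (1 + ε)) ^ 2 := by gcongr
    _ = (1 + ε) / (t * ε ^ 2) := by field_simp

theorem seedMeasure_real_injOn_singleEstimate_lt_le [Nontrivial U] {ε : ℝ} (hε : 0 < ε)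
    (hε1 : ε < 1) {t : ℕ} (ht : 2 ≤ t * ε) (S : Finset U) (hSM : S.card ≤ M) :
    F.seedMeasure.real
        {s | Set.InjOn (F.hash s) S ∧ singleEstimate t (F.hash s) S < (1 - ε) * S.card} ≤
      4 * (1 - ε) / (t * ε ^ 2) := by
  have ht0 : (0 : ℝ) < t := by nlinarith
  have hε' : 0 < 1 - ε := by linarith
  set q := ⌊t * M / ((1 - ε) * S.card)⌋₊
  have hunder : ∀ s, Set.InjOn (F.hash s) S ∧ singleEstimate t (F.hash s) S < (1 - ε) * S.card →
      t ≤ S.card ∧ q ≤ M ∧ hitCount (F.hash s) S q < t := fun s hs =>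
    hitCount_lt_of_singleEstimate_lt (Nat.cast_pos.1 ht0) hs.1
      (mul_le_of_le_one_left (by positivity) (by linarith)) hs.2
  by_cases hcond : t ≤ S.card ∧ q ≤ M
  swap
  · have hempty : {s | Set.InjOn (F.hash s) S ∧
        singleEstimate t (F.hash s) S < (1 - ε) * S.card} = ∅ :=
      Set.eq_empty_of_forall_notMem fun s hs => hcond ⟨(hunder s hs).1, (hunder s hs).2.1⟩
    rw [hempty, measureReal_empty]
    positivity
  obtain ⟨hle, hqM⟩ := hcond
  have hS0 : 0 < S.card := (Nat.cast_pos.1 ht0).trans_le hle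
  have hmean : (S.card * q / M : ℝ) ≤ t / (1 - ε) :=
    mul_floor_div_le hS0 (hS0.trans_le hSM) t hε'
  have hmean' : t / (1 - ε) - 1 ≤ (S.card * q / M : ℝ) :=
    sub_one_le_mul_floor_div hS0 hSM t hε'
  have hdev : t * ε / (2 * (1 - ε)) ≤ t / (1 - ε) - 1 - t := by
    rw [div_le_iff₀ (by positivity)]
    field_simp
    nlinarith
  calc F.seedMeasure.real
        {s | Set.InjOn (F.hash s) S ∧ singleEstimate t (F.hash s) S < (1 - ε) * S.card}
      ≤ F.seedMeasure.real
          {s | t * ε / (2 * (1 - ε)) ≤ |(hitCount (F.hash s) S q : ℝ) - S.card * q / M|} := by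
        refine measureReal_mono (fun s hs => ?_) (measure_ne_top _ _)
        have hhit : (hitCount (F.hash s) S q : ℝ) < t := Nat.cast_lt.2 (hunder s hs).2.2
        have hlower : t * ε / (2 * (1 - ε)) ≤ -(hitCount (F.hash s) S q - S.card * q / M) := by
          linarith
        exact hlower.trans (neg_le_abs _)
    _ ≤ S.card * q / M / (t * ε / (2 * (1 - ε))) ^ 2 :=
        F.seedMeasure_real_deviation_le S hqM (by positivity)
    _ ≤ t / (1 - ε) / (t * ε / (2 * (1 - ε))) ^ 2 := by gcongr
    _ = 4 * (1 - ε) / (t * ε ^ 2) := by field_simp; norm_num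

theorem seedMeasure_real_not_accurate_le [Nontrivial U] {ε : ℝ} (hε : 0 < ε) (hε1 : ε < 1)
    {t : ℕ} (ht : 2 ≤ t * ε) (S : Finset U) (hSM : S.card ≤ M) :
    F.seedMeasure.real {s | ¬ Accurate ε S.card (singleEstimate t (F.hash s) S)} ≤
      5 / (t * ε ^ 2) + S.card * (S.card - 1) / M := by
  set overestimate := {s | (1 + ε) * S.card < singleEstimate t (F.hash s) S}
  set underestimate :=
    {s | Set.InjOn (F.hash s) S ∧ singleEstimate t (F.hash s) S < (1 - ε) * S.card}
  set collision := {s | ¬ Set.InjOn (F.hash s) S}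
  have ht0 : (0 : ℝ) < t := by nlinarith
  have hcover : {s | ¬ Accurate ε S.card (singleEstimate t (F.hash s) S)} ⊆
      overestimate ∪ underestimate ∪ collision := by
    intro s (hs : ¬ (_ ∧ _))
    by_cases hinj : Set.InjOn (F.hash s) S
    · rcases not_and_or.1 hs with h | h
      · exact .inl (.inr ⟨hinj, not_le.1 h⟩)
      · exact .inl (.inl (not_le.1 h))
    · exact .inr hinj
  calc F.seedMeasure.real {s | ¬ Accurate ε S.card (singleEstimate t (F.hash s) S)}
      ≤ F.seedMeasure.real overestimate + F.seedMeasure.real underestimate +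
          F.seedMeasure.real collision :=
        (measureReal_mono hcover (measure_ne_top _ _)).trans <| (measureReal_union_le _ _).trans <|
          add_le_add_left (measureReal_union_le _ _) _
    _ ≤ (1 + ε) / (t * ε ^ 2) + 4 * (1 - ε) / (t * ε ^ 2) + S.card * (S.card - 1) / M := by
        gcongr
        · exact F.seedMeasure_real_lt_singleEstimate_le hε (Nat.cast_pos.1 ht0) S
        · exact F.seedMeasure_real_injOn_singleEstimate_lt_le hε hε1 ht S hSM
        · exact F.seedMeasure_real_not_injOn_le S
    _ ≤ 5 / (t * ε ^ 2) + S.card * (S.card - 1) / M := by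
        rw [← add_div]
        gcongr
        linarith

end HashFamily

end SingleEstimate

section Median

theorem length_le_two_mul_countP_notMem_of_median_notMem {s : Set ℝ} (hs : s.OrdConnected)
    (l : List ℝ) (h : median l ∉ s) : l.length ≤ 2 * l.countP (· ∉ s) := by
  rcases l.length.eq_zero_or_pos with hl | hl
  · exact hl.trans_le (Nat.zero_le _)
  rw [← (List.perm_insertionSort (· ≤ ·) l).countP_eq]
  have hsorted := List.pairwise_insertionSort (· ≤ ·) l
  have hlength := List.length_insertionSort (· ≤ ·) l
  rw [median] at h
  set m := l.length / 2
  set l' := l.insertionSort (· ≤ ·)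
  have hm : m < l'.length := by omega
  rw [List.getD_eq_getElem _ _ hm] at h
  have hmono {i j : ℕ} (hj : j < l'.length) (hij : i ≤ j) : l'[i] ≤ l'[j] :=
    hsorted.rel_get_of_le (a := ⟨i, hij.trans_lt hj⟩) (b := ⟨j, hj⟩) hij
  have houtside : (∀ x ∈ l'.take (m + 1), x ∉ s) ∨ ∀ x ∈ l'.drop m, x ∉ s := by
    by_contra! ⟨⟨x, hx, hxs⟩, ⟨y, hy, hys⟩⟩
    obtain ⟨i, hi, rfl⟩ := List.mem_take_iff_getElem.1 hx
    obtain ⟨j, hj, rfl⟩ := List.mem_drop_iff_getElem.1 hy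
    exact h (hs.out hxs hys ⟨hmono hm (by omega), hmono (by omega) (by omega)⟩)
  rcases houtside with hall | hall
  · have hcount := (List.take_sublist (m + 1) l').countP_le (p := (· ∉ s))
    rw [List.countP_eq_length.2 fun x hx => decide_eq_true (hall x hx), List.length_take] at hcount
    omega
  · have hcount := (List.drop_sublist m l').countP_le (p := (· ∉ s))
    rw [List.countP_eq_length.2 fun x hx => decide_eq_true (hall x hx), List.length_drop] at hcount
    omega

theorem le_two_mul_card_of_median_ofFn_notMem {s : Set ℝ} (hs : s.OrdConnected) {k : ℕ}
    {f : Fin k → ℝ} (h : median (List.ofFn f) ∉ s) :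
    k ≤ 2 * (Finset.univ.filter fun i => f i ∉ s).card := by
  have hcount := length_le_two_mul_countP_notMem_of_median_notMem hs _ h
  rw [List.length_ofFn, List.ofFn_eq_map, List.countP_map, List.countP_eq_length_filter] at hcount
  exact hcount

end Median

section Amplification

theorem two_pow_le_prod_ite_four {k : ℕ} {p : Fin k → Prop}
    (hp : k ≤ 2 * (Finset.univ.filter fun i => ¬ p i).card) :
    (2 : ℝ) ^ k ≤ ∏ i, if p i then 1 else 4 :=
  calc (2 : ℝ) ^ k ≤ 2 ^ (2 * (Finset.univ.filter fun i => ¬ p i).card) :=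
        pow_le_pow_right₀ one_le_two hp
    _ = ∏ i, if p i then 1 else 4 := by
        rw [pow_mul, Finset.prod_ite]
        norm_num

theorem failProb_majority_le {α : Type*} [Fintype α] [Nonempty α] {Q : α → Prop} {δ : ℝ}
    (hδ : 0 ≤ δ) (hQ : failProb (PMF.uniformOfFintype α) Q ≤ ENNReal.ofReal δ) (k : ℕ) :
    failProb (PMF.uniformOfFintype (Fin k → α))
        (fun σ => 2 * (Finset.univ.filter fun i => ¬ Q (σ i)).card < k) ≤
      ENNReal.ofReal (((1 + 3 * δ) / 2) ^ k) := by
  rw [failProb_uniformOfFintype_le_ofReal_iff hδ] at hQ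
  rw [failProb_uniformOfFintype_le_ofReal_iff (by positivity)]
  -- A sequence that fails for half of the indices has weight at least `4 ^ (k / 2)`, and the mean
  -- weight of a sequence is at most `(1 + 3 * δ) ^ k`.
  set w : α → ℝ := fun a => if Q a then 1 else 4
  have hw : ∀ a, 0 ≤ w a := fun a => by
    simp only [w]
    split_ifs <;> norm_num
  have hsum : ∑ a, w a ≤ (1 + 3 * δ) * Fintype.card α := by
    have hw_eq : ∀ a, w a = 1 + 3 * if ¬ Q a then 1 else 0 := fun a => by
      simp only [w]
      split_ifs <;> norm_num
    simp only [hw_eq, Finset.sum_add_distrib, ← Finset.mul_sum, Finset.sum_boole,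
      Finset.sum_const, Finset.card_univ, nsmul_eq_mul, mul_one]
    linarith
  set bad := Finset.univ.filter fun σ : Fin k → α =>
    ¬ 2 * (Finset.univ.filter fun i => ¬ Q (σ i)).card < k
  have hbad : bad.card * 2 ^ k ≤ ((1 + 3 * δ) * Fintype.card α) ^ k :=
    calc bad.card * 2 ^ k = ∑ _σ ∈ bad, (2 : ℝ) ^ k := by rw [Finset.sum_const, nsmul_eq_mul]
      _ ≤ ∑ σ ∈ bad, ∏ i, w (σ i) :=
          Finset.sum_le_sum fun σ hσ =>
            two_pow_le_prod_ite_four (not_lt.1 (Finset.mem_filter.1 hσ).2)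
      _ ≤ ∑ σ : Fin k → α, ∏ i, w (σ i) :=
          Finset.sum_le_univ_sum_of_nonneg fun σ => Finset.prod_nonneg fun i _ => hw _
      _ = (∑ a, w a) ^ k := (Fintype.sum_pow w k).symm
      _ ≤ ((1 + 3 * δ) * Fintype.card α) ^ k :=
          pow_le_pow_left₀ (Finset.sum_nonneg fun a _ => hw a) hsum k
  rw [Fintype.card_fun, Fintype.card_fin, Nat.cast_pow, div_pow, div_mul_eq_mul_div,
    le_div_iff₀ (by positivity), ← mul_pow]
  exact hbad

namespace HashFamily

variable {U : Type*} [Nontrivial U] {u t : ℕ} {ε : ℝ}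

theorem failProb_accurate_singleEstimate_le (F : HashFamily U (u ^ 3)) (hu : 2 ≤ u) (hε : 0 < ε)
    (hε1 : ε < 1) (ht : 2 ≤ t * ε) (S : Finset U) (hS : S.card ≤ u) :
    failProb (PMF.uniformOfFintype F.Seed)
        (fun s => Accurate ε S.card (singleEstimate t (F.hash s) S)) ≤
      ENNReal.ofReal (5 / (t * ε ^ 2) + 1 / 4) := by
  rw [failProb_eq_ofReal_real]
  refine ENNReal.ofReal_le_ofReal ((F.seedMeasure_real_not_accurate_le hε hε1 ht S
    (hS.trans (Nat.le_self_pow three_ne_zero u))).trans (add_le_add_right ?_ _))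
  have hu' : (2 : ℝ) ≤ u := Nat.ofNat_le_cast.2 hu
  have hS' : (S.card : ℝ) ≤ u := Nat.cast_le.2 hS
  rw [div_le_iff₀ (by positivity)]
  push_cast
  calc (S.card : ℝ) * (S.card - 1) ≤ u * (u - 1) := by nlinarith
    _ ≤ 1 / 4 * u ^ 3 := by nlinarith [mul_nonneg (Nat.cast_nonneg u) (sq_nonneg ((u : ℝ) - 2))]

theorem failProb_accurate_estimate_le (F : HashFamily U (u ^ 3)) (hu : 2 ≤ u) (hε : 0 < ε)
    (hε1 : ε < 1) (ht : 2 ≤ t * ε) (k : ℕ) (S : Finset U) (hS : S.card ≤ u) :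
    failProb (PMF.uniformOfFintype (Fin k → F.Seed))
        (fun σ => Accurate ε S.card (estimate F t k σ S)) ≤
      ENNReal.ofReal (((1 + 3 * (5 / (t * ε ^ 2) + 1 / 4)) / 2) ^ k) :=
  (failProb_mono fun _ hmajority => by_contra fun hmedian =>
    hmajority.not_ge (le_two_mul_card_of_median_ofFn_notMem Set.ordConnected_Icc hmedian)).trans <|
    failProb_majority_le (by positivity)
      (F.failProb_accurate_singleEstimate_le hu hε hε1 ht S hS) k

end HashFamily

end Amplification

section Estimates

theorem Accurate.eq_zero {ε x : ℝ} (h : Accurate ε 0 x) : x = 0 := by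
  simpa [Accurate] using h

theorem Accurate.mul_le_of_div_le {ε x x' r : ℝ} {m m' : ℕ} (hx : Accurate ε m x)
    (hx' : Accurate ε m' x') (hε : ε < 1) (hm : 0 < m) (hr : 0 ≤ r) (h : x' / x ≤ r) :
    (1 - ε) * m' ≤ r * ((1 + ε) * m) := by
  have hx_pos : 0 < x := (mul_pos (sub_pos.2 hε) (Nat.cast_pos.2 hm)).trans_le hx.1
  calc (1 - ε) * m' ≤ x' := hx'.1
    _ ≤ r * x := (div_le_iff₀ hx_pos).1 h
    _ ≤ r * ((1 + ε) * m) := mul_le_mul_of_nonneg_left hx.2 hr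

variable {V : Type*} [Fintype V]

/-- All estimates obtained in `H` are accurate up to the relative error `ε`. -/
def AccurateEstimates (ε : ℝ) (H : DAG V) (e : (V → ℝ) × (V → ℝ)) : Prop :=
  ∀ v, Accurate ε (H.anc v).card (e.1 v) ∧ Accurate ε (H.ancEdges v).card (e.2 v)

theorem failProb_estimates_le [Nontrivial V] (P : Params V) (H : DAG V) {ε : ℝ} (hε : 0 < ε)
    (hε1 : ε < 1) (ht : 2 ≤ P.t * ε) :
    failProb (estimates P H) (AccurateEstimates ε H) ≤ 2 * Fintype.card V *
      ENNReal.ofReal (((1 + 3 * (5 / (P.t * ε ^ 2) + 1 / 4)) / 2) ^ P.k) := by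
  set q := ENNReal.ofReal (((1 + 3 * (5 / (P.t * ε ^ 2) + 1 / 4)) / 2) ^ P.k)
  have hvert : failProb (PMF.uniformOfFintype (Fin P.k → P.vertHash.Seed)) (fun σ => ∀ v,
      Accurate ε (H.anc v).card (estimate P.vertHash P.t P.k σ (H.anc v))) ≤ Fintype.card V * q :=
    failProb_forall_le fun v => P.vertHash.failProb_accurate_estimate_le
      (Fintype.one_lt_card (α := V)) hε hε1 ht P.k _ (Finset.card_le_univ _)
  have hedge : failProb (PMF.uniformOfFintype (Fin P.k → P.edgeHash.Seed)) (fun τ => ∀ v,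
      Accurate ε (H.ancEdges v).card (estimate P.edgeHash P.t P.k τ (H.ancEdges v))) ≤
        Fintype.card V * q :=
    failProb_forall_le fun v => P.edgeHash.failProb_accurate_estimate_le
      (Fintype.one_lt_card (α := V × V)) hε hε1 ht P.k _ (Finset.card_le_univ _)
  calc failProb (estimates P H) (AccurateEstimates ε H)
      ≤ Fintype.card V * q + (Fintype.card V * q + 0) :=
        failProb_bind_le hvert fun σ _ hσ => failProb_bind_le hedge fun τ _ hτ =>
          (failProb_pure fun v => ⟨hσ v, hτ v⟩).le
    _ = 2 * Fintype.card V * q := by ring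

theorem failProb_estimates_one_third_le [Nontrivial V] (P : Params V) (H : DAG V)
    (ht : 720 ≤ P.t) :
    failProb (estimates P H) (AccurateEstimates (1 / 3) H) ≤
      2 * Fintype.card V * ENNReal.ofReal ((31 / 32) ^ P.k) := by
  have ht' : (720 : ℝ) ≤ P.t := by exact_mod_cast ht
  refine (failProb_estimates_le P H (by norm_num) (by norm_num) (by linarith)).trans ?_
  have hsingle : 5 / (P.t * (1 / 3 : ℝ) ^ 2) ≤ 1 / 16 := by
    rw [div_le_iff₀ (by positivity)]
    linarith
  have hbase : (1 + 3 * (5 / (P.t * (1 / 3 : ℝ) ^ 2) + 1 / 4)) / 2 ≤ 31 / 32 := by linarith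
  gcongr

end Estimates

section Residual

variable {V : Type*} {H : DAG V} {A A' B B' : Finset V} {v : V} {δ δ' : ℝ}

namespace DAG

/-- The part of `H` that is left after the batch `B` has been scheduled. -/
abbrev residual (H : DAG V) (B : Finset V) : DAG V := H.remove (H.ancSet B)

theorem anc_remove_subset (H : DAG V) (A : Finset V) (v : V) :
    (H.remove A).anc v ⊆ H.anc v \ A := fun u hu => by
  obtain ⟨huA, hpath⟩ := Finset.mem_filter.1 hu
  obtain ⟨huH, huA⟩ := Finset.mem_sdiff.1 huA
  exact Finset.mem_sdiff.2 ⟨Finset.mem_filter.2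
    ⟨huH, Relation.ReflTransGen.mono (fun a b h => (Finset.mem_filter.1 h).1) _ _ hpath⟩, huA⟩

theorem ancEdges_residual_subset (H : DAG V) (B : Finset V) (v : V) :
    (H.residual B).ancEdges v ⊆ H.ancEdges v \ H.ancEdgesSet B := fun e he => by
  obtain ⟨hedge, hfst, hsnd⟩ := Finset.mem_filter.1 he
  obtain ⟨hfst, hfstB⟩ := Finset.mem_sdiff.1 (H.anc_remove_subset _ _ hfst)
  obtain ⟨hsnd, -⟩ := Finset.mem_sdiff.1 (H.anc_remove_subset _ _ hsnd)
  exact Finset.mem_sdiff.2 ⟨Finset.mem_filter.2 ⟨(Finset.mem_filter.1 hedge).1, hfst, hsnd⟩,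
    fun heB => hfstB (Finset.mem_filter.1 heB).2.1⟩

theorem edges_remove_anti (H : DAG V) (hA : A ⊆ A') : (H.remove A').edges ⊆ (H.remove A).edges :=
  Finset.monotone_filter_right _ fun _ _ he => ⟨fun h => he.1 (hA h), fun h => he.2 (hA h)⟩

theorem anc_remove_anti (H : DAG V) (hA : A ⊆ A') (v : V) :
    (H.remove A').anc v ⊆ (H.remove A).anc v := fun u hu => by
  obtain ⟨huA', hpath⟩ := Finset.mem_filter.1 hu
  exact Finset.mem_filter.2 ⟨Finset.sdiff_subset_sdiff subset_rfl hA huA',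
    Relation.ReflTransGen.mono (fun a b h => H.edges_remove_anti hA h) _ _ hpath⟩

theorem ancEdges_remove_anti (H : DAG V) (hA : A ⊆ A') (v : V) :
    (H.remove A').ancEdges v ⊆ (H.remove A).ancEdges v := fun e he => by
  obtain ⟨hedge, hfst, hsnd⟩ := Finset.mem_filter.1 he
  exact Finset.mem_filter.2
    ⟨H.edges_remove_anti hA hedge, H.anc_remove_anti hA v hfst, H.anc_remove_anti hA v hsnd⟩

theorem ancSet_mono (H : DAG V) (hB : B ⊆ B') : H.ancSet B ⊆ H.ancSet B' :=
  Finset.biUnion_subset_biUnion_of_subset_left _ hB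

end DAG

/-- Scheduling the batch `B` leaves at most a `δ`-fraction of the ancestors of `v`, or of its
ancestor edges. The second alternative requires an ancestor edge, as it would otherwise hold
without any effect of `B`. -/
def Reduced (δ : ℝ) (H : DAG V) (B : Finset V) (v : V) : Prop :=
  (((H.residual B).anc v).card : ℝ) ≤ δ * (H.anc v).card ∨
    ((H.ancEdges v).Nonempty ∧
      (((H.residual B).ancEdges v).card : ℝ) ≤ δ * (H.ancEdges v).card)

theorem Reduced.mono (h : Reduced δ H B v) (hδ : δ ≤ δ') (hB : B ⊆ B') : Reduced δ' H B' v := by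
  have hanc : (((H.residual B').anc v).card : ℝ) ≤ ((H.residual B).anc v).card :=
    Nat.cast_le.2 (Finset.card_le_card (H.anc_remove_anti (H.ancSet_mono hB) v))
  have hedge : (((H.residual B').ancEdges v).card : ℝ) ≤ ((H.residual B).ancEdges v).card :=
    Nat.cast_le.2 (Finset.card_le_card (H.ancEdges_remove_anti (H.ancSet_mono hB) v))
  exact h.imp
    (fun h => hanc.trans (h.trans (mul_le_mul_of_nonneg_right hδ (Nat.cast_nonneg _))))
    fun h => ⟨h.1, hedge.trans (h.2.trans (mul_le_mul_of_nonneg_right hδ (Nat.cast_nonneg _)))⟩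

theorem reduced_of_mem (hδ : 0 ≤ δ) (H : DAG V) (hv : v ∈ B) : Reduced δ H B v := by
  have hanc : (H.residual B).anc v = ∅ := Finset.subset_empty.1 <|
    (H.anc_remove_subset _ v).trans
      (Finset.sdiff_eq_empty_iff_subset.2 (Finset.subset_biUnion_of_mem H.anc hv)).subset
  left
  rw [hanc, Finset.card_empty, Nat.cast_zero]
  positivity

theorem reduced_of_ratio_le {e e' : (V → ℝ) × (V → ℝ)} (he : AccurateEstimates (1 / 3) H e)
    (he' : AccurateEstimates (1 / 3) (H.residual B) e') {γ : ℝ} (hγ : 0 ≤ γ) (hv : v ∈ H.verts)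
    (h : e'.1 v / e.1 v ≤ 2 * γ ∨ e.2 v ≠ 0 ∧ e'.2 v / e.2 v ≤ 2 * γ) :
    Reduced (4 * γ) H B v := by
  rcases h with hratio | ⟨hne, hratio⟩
  · have hpos : 0 < (H.anc v).card := Finset.card_pos.2 ⟨v, H.self_mem_anc hv⟩
    have hle := (he v).1.mul_le_of_div_le (he' v).1 (by norm_num) hpos (by positivity) hratio
    left
    linarith
  · have hpos : 0 < (H.ancEdges v).card := by
      refine Nat.pos_of_ne_zero fun hzero => hne ?_
      exact Accurate.eq_zero (hzero ▸ (he v).2)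
    have hle := (he v).2.mul_le_of_div_le (he' v).2 (by norm_num) hpos (by positivity) hratio
    right
    exact ⟨Finset.card_pos.1 hpos, by linarith⟩

/-- Every vertex of `H` outside `R` is reduced by `B`. With `R` the vertices in buckets, this is the
invariant of `FindBatch`. -/
def ReducedOutside (δ : ℝ) (H : DAG V) (R B : Finset V) : Prop :=
  ∀ v ∈ H.verts, v ∉ R → Reduced δ H B v

theorem ReducedOutside.erase {R : Finset V} (h : ReducedOutside δ H R B) (hB : B ⊆ B')
    (hv : Reduced δ H B' v) : ReducedOutside δ H (R.erase v) B' := fun w hw hwR => by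
  rcases eq_or_ne w v with rfl | hne
  · exact hv
  · exact (h w hw fun hR => hwR (Finset.mem_erase.2 ⟨hne, hR⟩)).mono le_rfl hB

/-- Every vertex of `H` is reduced by the batch `B`. -/
def IsGoodBatch (δ : ℝ) (H : DAG V) (B : Finset V) : Prop := ∀ v ∈ H.verts, Reduced δ H B v

/-- A sequence of batches that schedules `H` and in which every batch is good for the part of `H`
that is left by the previous ones. -/
def IsGoodRun (δ : ℝ) : DAG V → List (Finset V) → Prop
  | H, [] => H.verts = ∅
  | H, B :: L => H.verts.Nonempty ∧ IsGoodBatch δ H B ∧ IsGoodRun δ (H.residual B) L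

end Residual

section Algorithm

variable {V : Type*} [Fintype V] {P : Params V} {H : DAG V} {R B : Finset V} {v : V}
  {δ : ℝ} {q : ℝ≥0∞}

theorem reduced_of_not_fresh (h : ¬ Fresh P H B v) : Reduced P.γ H B v := by
  rw [Fresh, not_and_or, not_or, not_lt, not_lt, ← ne_eq, ← Finset.nonempty_iff_ne_empty] at h
  exact h.imp
    (fun h => (Nat.cast_le.2 (Finset.card_le_card (H.anc_remove_subset _ v))).trans h)
    fun h => ⟨h.1, (Nat.cast_le.2 (Finset.card_le_card (H.ancEdges_residual_subset B v))).trans h.2⟩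

theorem reducedOutside_of_mem_support_sampleBucket (hδ : P.γ ≤ δ) (idx : V → ℕ) (i s : ℕ)
    (hRB : ReducedOutside δ H R B) :
    ∀ r ∈ (sampleBucket P H idx i R B s).support, ReducedOutside δ H r.1 r.2 := by
  fun_induction sampleBucket P H idx i R B s with
  | case1 R B s h ih_fresh ih_stale =>
    intro r hr
    obtain ⟨v, hv, hr⟩ := (PMF.mem_support_bindOnSupport_iff _ r).1 hr
    split_ifs at hr with hfresh
    · exact ih_fresh v hv (hRB.erase (Finset.subset_insert _ _)
        (reduced_of_mem (P.γ_pos.le.trans hδ) H (Finset.mem_insert_self _ _))) r hr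
    · exact ih_stale v hv
        (hRB.erase subset_rfl ((reduced_of_not_fresh hfresh).mono hδ subset_rfl)) r hr
  | case2 R B _ _ =>
    intro r hr
    rwa [(PMF.mem_support_pure_iff _ _).1 hr]

theorem reducedOutside_of_mem_support_sampleBuckets (hδ : P.γ ≤ δ) (idx : V → ℕ) (j : ℕ)
    (hRB : ReducedOutside δ H R B) :
    ∀ r ∈ (sampleBuckets P H idx j R B).support, ReducedOutside δ H r.1 r.2 := by
  induction j generalizing R B with
  | zero =>
    intro r hr
    rwa [(PMF.mem_support_pure_iff _ _).1 hr]
  | succ j ih =>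
    intro r hr
    obtain ⟨r', hr', hr⟩ := (PMF.mem_support_bind_iff _ _ _).1 hr
    exact ih (reducedOutside_of_mem_support_sampleBucket hδ idx j 0 hRB r' hr') r hr

theorem failProb_prune_le (hq : ∀ H, failProb (estimates P H) (AccurateEstimates (1 / 3) H) ≤ q)
    (hRB : ReducedOutside (4 * P.γ) H R B) :
    failProb (prune P H B R) (fun R' => ReducedOutside (4 * P.γ) H R' B) ≤ 2 * q := by
  have hprune : failProb (prune P H B R) (fun R' => ReducedOutside (4 * P.γ) H R' B) ≤
      q + (q + 0) :=
    failProb_bind_le (hq H) fun e _ he => failProb_bind_le (hq _) fun e' _ he' =>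
      (failProb_pure fun v hv hvR => by
        by_cases hR : v ∈ R
        · rw [Finset.mem_filter, not_and, not_not] at hvR
          exact reduced_of_ratio_le he he' P.γ_pos.le hv (hvR hR)
        · exact hRB v hv hR).le
  rwa [add_zero, ← two_mul] at hprune

theorem failProb_samplePass_le
    (hq : ∀ H, failProb (estimates P H) (AccurateEstimates (1 / 3) H) ≤ q) (idx : V → ℕ)
    (hRB : ReducedOutside (4 * P.γ) H R B) :
    failProb (samplePass P H idx R B) (fun r => ReducedOutside (4 * P.γ) H r.1 r.2) ≤ 2 * q := by
  have hδ : P.γ ≤ 4 * P.γ := by linarith [P.γ_pos]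
  have hpass : failProb (samplePass P H idx R B)
      (fun r => ReducedOutside (4 * P.γ) H r.1 r.2) ≤ 0 + (2 * q + 0) :=
    failProb_bind_le
      (failProb_eq_zero (reducedOutside_of_mem_support_sampleBuckets hδ idx _ hRB)).le
      fun r _ hr => failProb_bind_le (failProb_prune_le hq hr) fun R' _ hR' =>
        le_of_eq (failProb_pure hR')
  rwa [zero_add, add_zero] at hpass

theorem failProb_batchLoop_le
    (hq : ∀ H, failProb (estimates P H) (AccurateEstimates (1 / 3) H) ≤ q) (idx : V → ℕ)
    (hRB : ReducedOutside (4 * P.γ) H R B) :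
    failProb (batchLoop P H idx R B) (IsGoodBatch (4 * P.γ) H) ≤ R.card * (2 * q) := by
  fun_induction batchLoop P H idx R B with
  | case1 R B h ih =>
    obtain ⟨n, hn⟩ := Nat.exists_eq_succ_of_ne_zero h.card_ne_zero
    rw [hn, Nat.cast_succ, add_one_mul, add_comm]
    refine failProb_bindOnSupport_le (failProb_samplePass_le hq idx hRB) fun r hr hr_red =>
      (ih r hr hr_red).trans ?_
    have hcard := Finset.card_lt_card (samplePass_support P H idx R B h r hr).1
    gcongr
    omega
  | case2 R B h =>
    rw [Finset.not_nonempty_iff_eq_empty] at h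
    exact (failProb_pure fun v hv => hRB v hv (h ▸ Finset.notMem_empty v)).trans_le zero_le

theorem failProb_findBatch_le
    (hq : ∀ H, failProb (estimates P H) (AccurateEstimates (1 / 3) H) ≤ q) (H : DAG V) :
    failProb (findBatch P H) (IsGoodBatch (4 * P.γ) H) ≤ Fintype.card V * (2 * q) :=
  calc failProb (findBatch P H) (IsGoodBatch (4 * P.γ) H) ≤ 0 + H.verts.card * (2 * q) :=
        failProb_bind_le (Q := fun _ => True) (failProb_eq_zero fun _ _ => trivial).le
          fun e _ _ => failProb_batchLoop_le hq _ fun v hv hvH => absurd hv hvH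
    _ ≤ Fintype.card V * (2 * q) := by
        rw [zero_add]
        gcongr
        exact Finset.card_le_univ _

theorem failProb_scheduleSmallSubgraph_le
    (hq : ∀ H, failProb (estimates P H) (AccurateEstimates (1 / 3) H) ≤ q) (H : DAG V) :
    failProb (scheduleSmallSubgraph P H) (IsGoodRun (4 * P.γ) H) ≤
      H.verts.card * (Fintype.card V * (2 * q)) := by
  fun_induction scheduleSmallSubgraph P H with
  | case1 H h ih =>
    obtain ⟨n, hn⟩ := Nat.exists_eq_succ_of_ne_zero h.card_ne_zero
    rw [hn, Nat.cast_succ, add_one_mul, add_comm,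
      ← add_zero ((n : ℝ≥0∞) * (Fintype.card V * (2 * q)))]
    refine failProb_bindOnSupport_le (failProb_findBatch_le hq H) fun B hB hB_good =>
      failProb_bind_le ((ih B hB).trans ?_) fun L _ hL => (failProb_pure ⟨h, hB_good, hL⟩).le
    have hcard := findBatch_progress P H h B hB
    gcongr
    omega
  | case2 H h =>
    have hnil : IsGoodRun (4 * P.γ) H [] := Finset.not_nonempty_iff_eq_empty.1 h
    exact (failProb_pure hnil).trans_le zero_le

end Algorithm

section NumberOfBatches

variable {V : Type*} {δ : ℝ} {H : DAG V} {B B' : Finset V} {v : V} {n : ℕ}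

namespace DAG

theorem card_anc_residual_le (H : DAG V) (B : Finset V) (v : V) :
    ((H.residual B).anc v).card ≤ (H.anc v).card :=
  Finset.card_le_card ((H.anc_remove_subset _ v).trans Finset.sdiff_subset)

theorem card_ancEdges_residual_le (H : DAG V) (B : Finset V) (v : V) :
    ((H.residual B).ancEdges v).card ≤ (H.ancEdges v).card :=
  Finset.card_le_card ((H.ancEdges_residual_subset B v).trans Finset.sdiff_subset)

theorem card_anc_le_card_ancEdges_add_one (H : DAG V) (v : V) :
    (H.anc v).card ≤ (H.ancEdges v).card + 1 := by
  have hsub : H.anc v ⊆ insert v ((H.ancEdges v).image Prod.fst) := fun u hu => by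
    rcases (Finset.mem_filter.1 hu).2.cases_head with rfl | ⟨w, huw, hwv⟩
    · exact Finset.mem_insert_self _ _
    · have hw : w ∈ H.anc v := Finset.mem_filter.2 ⟨(H.edges_mem _ huw).2, hwv⟩
      exact Finset.mem_insert_of_mem
        (Finset.mem_image.2 ⟨(u, w), Finset.mem_filter.2 ⟨huw, hu, hw⟩, rfl⟩)
  exact (Finset.card_le_card hsub).trans
    ((Finset.card_insert_le _ _).trans (Nat.add_le_add_right Finset.card_image_le 1))

theorem two_mul_card_ancEdges_le_sq_card_anc (H : DAG V) (v : V) :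
    2 * (H.ancEdges v).card ≤ (H.anc v).card ^ 2 := by
  have hdisj : Disjoint (H.ancEdges v) ((H.ancEdges v).image Prod.swap) := by
    rw [Finset.disjoint_left]
    rintro ⟨a, b⟩ hab hba
    obtain ⟨⟨c, d⟩, hcd, h⟩ := Finset.mem_image.1 hba
    obtain ⟨rfl, rfl⟩ := Prod.mk.inj h
    exact H.acyclic d (.tail (.single (Finset.mem_filter.1 hab).1) (Finset.mem_filter.1 hcd).1)
  have hsub : H.ancEdges v ∪ (H.ancEdges v).image Prod.swap ⊆ H.anc v ×ˢ H.anc v := by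
    refine Finset.union_subset (fun e he => Finset.mem_product.2 (Finset.mem_filter.1 he).2)
      (Finset.image_subset_iff.2 fun e he => ?_)
    exact Finset.mem_product.2 (Finset.mem_filter.1 he).2.symm
  calc 2 * (H.ancEdges v).card = (H.ancEdges v ∪ (H.ancEdges v).image Prod.swap).card := by
        rw [Finset.card_union_of_disjoint hdisj,
          Finset.card_image_of_injective _ Prod.swap_injective, two_mul]
    _ ≤ (H.anc v).card ^ 2 := by
        rw [sq, ← Finset.card_product]
        exact Finset.card_le_card hsub

theorem two_le_card_anc (h : (H.ancEdges v).Nonempty) : 2 ≤ (H.anc v).card := by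
  have hpos := h.card_pos
  have hsq := H.two_mul_card_ancEdges_le_sq_card_anc v
  nlinarith

end DAG

theorem Reduced.ancEdges_nonempty (h : Reduced δ H B v) (hδ1 : δ < 1)
    (hv : v ∈ (H.residual B).verts) : (H.ancEdges v).Nonempty := by
  rcases h with hanc | ⟨hne, -⟩
  · have hleft : (1 : ℝ) ≤ ((H.residual B).anc v).card :=
      Nat.one_le_cast.2 (Finset.card_pos.2 ⟨v, (H.residual B).self_mem_anc hv⟩)
    have hle : (((H.residual B).anc v).card : ℝ) ≤ (H.anc v).card :=
      mod_cast H.card_anc_residual_le B v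
    have htwo : 1 < (H.anc v).card := Nat.one_lt_cast.1 <| hleft.trans_lt <|
      hanc.trans_lt (mul_lt_of_lt_one_left (by linarith) hδ1)
    have hedge := H.card_anc_le_card_ancEdges_add_one v
    exact Finset.card_pos.1 (by omega)
  · exact hne

theorem Reduced.one_le_mul_card_ancEdges (h : Reduced δ H B v) (hδ0 : 0 < δ) (hδ1 : δ < 1)
    (he : ((H.residual B).ancEdges v).Nonempty) : 1 ≤ δ * (H.ancEdges v).card := by
  rcases h with hanc | ⟨-, hedge⟩
  · have htwo : (2 : ℝ) ≤ ((H.residual B).anc v).card :=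
      Nat.ofNat_le_cast.2 (DAG.two_le_card_anc he)
    have hle : ((H.anc v).card : ℝ) ≤ (H.ancEdges v).card + 1 :=
      mod_cast H.card_anc_le_card_ancEdges_add_one v
    linarith [mul_le_mul_of_nonneg_left hle hδ0.le]
  · exact (Nat.one_le_cast.2 he.card_pos).trans hedge

theorem Reduced.two_mul_card_ancEdges_le (hδ0 : 0 < δ) (h : Reduced δ H B v)
    (h' : Reduced δ (H.residual B) B' v) :
    2 * (((H.residual B).residual B').ancEdges v).card ≤ δ ^ 2 * ((H.anc v).card : ℝ) ^ 2 := by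
  have hsq (G : DAG V) : 2 * ((G.ancEdges v).card : ℝ) ≤ ((G.anc v).card : ℝ) ^ 2 :=
    mod_cast G.two_mul_card_ancEdges_le_sq_card_anc v
  have hanc_mono : (((H.residual B).anc v).card : ℝ) ≤ (H.anc v).card :=
    mod_cast H.card_anc_residual_le B v
  have hedge_mono : ((((H.residual B).residual B').ancEdges v).card : ℝ) ≤
      ((H.residual B).ancEdges v).card := mod_cast (H.residual B).card_ancEdges_residual_le B' v
  rw [← mul_pow]
  rcases h with hanc | ⟨-, hedge⟩
  · calc _ ≤ 2 * (((H.residual B).ancEdges v).card : ℝ) := by gcongr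
      _ ≤ (((H.residual B).anc v).card : ℝ) ^ 2 := hsq _
      _ ≤ (δ * (H.anc v).card) ^ 2 := by gcongr
  rcases h' with hanc' | ⟨-, hedge'⟩
  · calc _ ≤ ((((H.residual B).residual B').anc v).card : ℝ) ^ 2 := hsq _
      _ ≤ (δ * ((H.residual B).anc v).card) ^ 2 := by gcongr
      _ ≤ (δ * (H.anc v).card) ^ 2 := by gcongr
  · calc _ ≤ 2 * (δ * (δ * ((H.ancEdges v).card : ℝ))) := by
          gcongr
          exact hedge'.trans (by gcongr)
      _ = δ ^ 2 * (2 * (H.ancEdges v).card) := by ring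
      _ ≤ δ ^ 2 * ((H.anc v).card : ℝ) ^ 2 := by gcongr; exact hsq H
      _ = (δ * (H.anc v).card) ^ 2 := by ring

/-- There are `n` successive batches, starting from `H`, that all reduce `v` by the factor `δ` and
after which `v` is still not scheduled. -/
def Outlasts (δ : ℝ) (v : V) : ℕ → DAG V → Prop
  | 0, H => v ∈ H.verts
  | n + 1, H => ∃ B, Reduced δ H B v ∧ Outlasts δ v n (H.residual B)

namespace Outlasts

theorem mem_verts (h : Outlasts δ v n H) : v ∈ H.verts := by
  induction n generalizing H with
  | zero => exact h
  | succ n ih =>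
    obtain ⟨B, -, h⟩ := h
    exact (Finset.mem_sdiff.1 (ih h)).1

theorem ancEdges_nonempty (hδ1 : δ < 1) (h : Outlasts δ v (n + 1) H) :
    (H.ancEdges v).Nonempty := by
  obtain ⟨B, hB, h⟩ := h
  exact hB.ancEdges_nonempty hδ1 h.mem_verts

theorem one_le_mul_card_ancEdges (hδ0 : 0 < δ) (hδ1 : δ < 1) (h : Outlasts δ v (n + 2) H) :
    1 ≤ δ * (H.ancEdges v).card := by
  obtain ⟨B, hB, h⟩ := h
  exact hB.one_le_mul_card_ancEdges hδ0 hδ1 (h.ancEdges_nonempty hδ1)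

theorem two_le_sq_mul_sq (hδ0 : 0 < δ) (hδ1 : δ < 1) (h : Outlasts δ v (n + 3) H) :
    2 ≤ δ ^ 2 * ((H.anc v).card : ℝ) ^ 2 := by
  obtain ⟨B, hB, B', hB', h⟩ := h
  have hedge : (1 : ℝ) ≤ (((H.residual B).residual B').ancEdges v).card :=
    Nat.one_le_cast.2 (h.ancEdges_nonempty hδ1).card_pos
  linarith [hB.two_mul_card_ancEdges_le hδ0 hB']

theorem two_le_cube_mul_sq (hδ0 : 0 < δ) (hδ1 : δ < 1) (h : Outlasts δ v (n + 4) H) :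
    2 ≤ δ ^ 3 * ((H.anc v).card : ℝ) ^ 2 := by
  obtain ⟨B, hB, B', hB', h⟩ := h
  calc (2 : ℝ) ≤ δ * (2 * (((H.residual B).residual B').ancEdges v).card) := by
        linarith [h.one_le_mul_card_ancEdges hδ0 hδ1]
    _ ≤ δ * (δ ^ 2 * ((H.anc v).card : ℝ) ^ 2) :=
        mul_le_mul_of_nonneg_left (hB.two_mul_card_ancEdges_le hδ0 hB') hδ0.le
    _ = δ ^ 3 * ((H.anc v).card : ℝ) ^ 2 := by ring

theorem exists_two_le_pow_mul_card_anc (hδ0 : 0 < δ) (hδ1 : δ < 1) (h : Outlasts δ v (n + 1) H) :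
    ∃ α β : ℕ, α + β = n ∧ 2 ≤ δ ^ α * (H.anc v).card ∧ 1 ≤ δ ^ β * (H.ancEdges v).card := by
  induction n generalizing H with
  | zero =>
    have hne := h.ancEdges_nonempty hδ1
    refine ⟨0, 0, rfl, ?_, ?_⟩ <;> rw [pow_zero, one_mul]
    · exact Nat.ofNat_le_cast.2 (DAG.two_le_card_anc hne)
    · exact Nat.one_le_cast.2 hne.card_pos
  | succ n ih =>
    obtain ⟨B, hB, h⟩ := h
    obtain ⟨α, β, hαβ, hα, hβ⟩ := ih h
    have hanc_mono : (((H.residual B).anc v).card : ℝ) ≤ (H.anc v).card :=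
      mod_cast H.card_anc_residual_le B v
    have hedge_mono : (((H.residual B).ancEdges v).card : ℝ) ≤ (H.ancEdges v).card :=
      mod_cast H.card_ancEdges_residual_le B v
    rcases hB with hanc | ⟨-, hedge⟩
    · refine ⟨α + 1, β, by omega, hα.trans ?_, hβ.trans (by gcongr)⟩
      rw [pow_succ, mul_assoc]
      gcongr
    · refine ⟨α, β + 1, by omega, hα.trans (by gcongr), hβ.trans ?_⟩
      rw [pow_succ, mul_assoc]
      gcongr

theorem one_le_pow_mul_pow_four (hδ0 : 0 < δ) (hδ1 : δ < 1) (h : Outlasts δ v (n + 3) H) :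
    1 ≤ δ ^ (n + 4) * ((H.anc v).card : ℝ) ^ 4 := by
  obtain ⟨α, β, hαβ, hα, hβ⟩ := h.exists_two_le_pow_mul_card_anc hδ0 hδ1
  have hsq : 2 * ((H.ancEdges v).card : ℝ) ≤ ((H.anc v).card : ℝ) ^ 2 :=
    mod_cast H.two_mul_card_ancEdges_le_sq_card_anc v
  set a : ℝ := ((H.anc v).card : ℝ)
  replace hβ : 1 ≤ δ ^ β * a ^ 2 := hβ.trans <| by
    gcongr
    linarith [Nat.cast_nonneg (α := ℝ) (H.ancEdges v).card]
  have hpow_le {i j : ℕ} (hij : i ≤ j) : δ ^ j ≤ δ ^ i :=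
    pow_le_pow_of_le_one hδ0.le hδ1.le hij
  rcases le_or_gt 2 α with hα2 | hα2
  · have hα' : 1 ≤ δ ^ 2 * a := by
      linarith [mul_le_mul_of_nonneg_right (hpow_le hα2) (Nat.cast_nonneg (H.anc v).card)]
    calc 1 ≤ (δ ^ α * a) * (δ ^ β * a ^ 2) * (δ ^ 2 * a) :=
          one_le_mul_of_one_le_of_one_le
            (one_le_mul_of_one_le_of_one_le (one_le_two.trans hα) hβ) hα'
      _ = δ ^ (α + β + 2) * a ^ 4 := by ring
      _ = δ ^ (n + 4) * a ^ 4 := by rw [hαβ]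
  cases n with
  | zero =>
    calc 1 ≤ (δ ^ 2 * a ^ 2) ^ 2 := one_le_pow₀ (one_le_two.trans (h.two_le_sq_mul_sq hδ0 hδ1))
      _ = δ ^ (0 + 4) * a ^ 4 := by ring
  | succ n =>
    calc 1 ≤ (δ ^ 3 * a ^ 2) * (δ ^ β * a ^ 2) :=
          one_le_mul_of_one_le_of_one_le (one_le_two.trans (h.two_le_cube_mul_sq hδ0 hδ1)) hβ
      _ = δ ^ (3 + β) * a ^ 4 := by ring
      _ ≤ δ ^ (n + 1 + 4) * a ^ 4 :=
          mul_le_mul_of_nonneg_right (hpow_le (by omega)) (by positivity)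

end Outlasts

theorem natCast_le_mul_logb_of_one_le_pow_mul_pow {x : ℝ} {m k : ℕ} (hδ0 : 0 < δ) (hδ1 : δ < 1)
    (hx : 0 < x) (h : 1 ≤ δ ^ m * x ^ k) : (m : ℝ) ≤ k * Real.logb (1 / δ) x := by
  have hbase : 1 < 1 / δ := one_lt_one_div hδ0 hδ1
  rw [← Real.logb_pow, Real.le_logb_iff_rpow_le hbase (by positivity), Real.rpow_natCast,
    one_div_pow, div_le_iff₀' (by positivity)]
  exact h

theorem IsGoodRun.exists_outlasts {L : List (Finset V)} (hL : IsGoodRun δ H L)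
    (hn : L.length = n + 1) : ∃ v, Outlasts δ v n H := by
  induction n generalizing H L with
  | zero =>
    obtain ⟨B, rfl⟩ := List.length_eq_one_iff.1 hn
    exact hL.1
  | succ n ih =>
    obtain ⟨B, L, rfl⟩ := List.exists_cons_of_length_eq_add_one hn
    obtain ⟨-, hB, hL⟩ := hL
    obtain ⟨v, hv⟩ := ih hL (Nat.succ_inj.1 hn)
    exact ⟨v, B, hB v (Finset.mem_sdiff.1 hv.mem_verts).1, hv⟩

theorem IsGoodRun.length_le {L : List (Finset V)} (hL : IsGoodRun δ H L) (hδ0 : 0 < δ)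
    (hδ1 : δ < 1) {ρ : ℕ} (hH : H.IsSmall ρ) :
    (L.length : ℝ) ≤ max 3 (4 * Real.logb (1 / δ) (2 * (ρ : ℝ))) := by
  rcases le_or_gt L.length 3 with hle | hgt
  · exact le_max_of_le_left (Nat.cast_le_ofNat.2 hle)
  obtain ⟨n, hn⟩ : ∃ n, L.length = n + 4 := ⟨L.length - 4, by omega⟩
  obtain ⟨v, hv⟩ := hL.exists_outlasts hn
  have hsmall : ((H.anc v).card : ℝ) ≤ 2 * ρ := mod_cast hH v hv.mem_verts
  have hpos : (0 : ℝ) < (H.anc v).card :=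
    Nat.cast_pos.2 (Finset.card_pos.2 ⟨v, H.self_mem_anc hv.mem_verts⟩)
  refine le_max_of_le_right (hn ▸ natCast_le_mul_logb_of_one_le_pow_mul_pow (k := 4) hδ0 hδ1
    (hpos.trans_le hsmall) ((hv.one_le_pow_mul_pow_four hδ0 hδ1).trans ?_))
  gcongr

end NumberOfBatches

section GoodRun

variable {n k : ℕ} {b d : ℝ}

theorem pow_le_rpow_neg {x y : ℝ} (hx0 : 0 < x) (hx1 : x < 1) (hy : 1 ≤ y)
    (hk : b / Real.log x⁻¹ * Real.log y ≤ k) : x ^ k ≤ y ^ (-b) := by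
  have hlog : 0 < Real.log x⁻¹ := Real.log_pos ((one_lt_inv₀ hx0).2 hx1)
  rw [div_mul_eq_mul_div, div_le_iff₀ hlog, Real.log_inv] at hk
  rw [← Real.rpow_natCast, Real.rpow_def_of_pos hx0, Real.rpow_def_of_pos (one_pos.trans_le hy),
    Real.exp_le_exp]
  linarith

theorem four_mul_cube_mul_pow_le (hn : 2 ≤ n)
    (hk : (d + 5) / Real.log (32 / 31) * Real.log n ≤ k) :
    4 * (n : ℝ) ^ 3 * (31 / 32) ^ k ≤ 1 / (n : ℝ) ^ d := by
  have hn2 : (2 : ℝ) ≤ n := Nat.ofNat_le_cast.2 hn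
  have hn0 : (0 : ℝ) < n := by linarith
  have hpow : (31 / 32 : ℝ) ^ k ≤ (n : ℝ) ^ (-(d + 5)) :=
    pow_le_rpow_neg (by norm_num) (by norm_num) (by linarith) (by rwa [inv_div])
  calc 4 * (n : ℝ) ^ 3 * (31 / 32) ^ k ≤ (n : ℝ) ^ 2 * (n : ℝ) ^ 3 * (n : ℝ) ^ (-(d + 5)) := by
        gcongr
        nlinarith
    _ = 1 / (n : ℝ) ^ d := by
        rw [← pow_add, ← Real.rpow_natCast, ← Real.rpow_add hn0, one_div, ← Real.rpow_neg hn0.le]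
        push_cast
        ring_nf

theorem failProb_isGoodRun_le {V : Type*} [Fintype V] (P : Params V) (H : DAG V)
    (ht : 720 ≤ P.t) (hk : (d + 5) / Real.log (32 / 31) * Real.log (Fintype.card V) ≤ P.k) :
    failProb (scheduleSmallSubgraph P H) (IsGoodRun (4 * P.γ) H) ≤
      ENNReal.ofReal (1 / (Fintype.card V : ℝ) ^ d) := by
  have hcard : H.verts.card ≤ Fintype.card V := Finset.card_le_univ _
  rcases lt_trichotomy (Fintype.card V) 1 with hV | hV | hV
  · have hfail := failProb_scheduleSmallSubgraph_le (fun G => failProb_le_one (estimates P G) _) H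
    have hzero : H.verts.card = 0 := by omega
    rw [hzero, Nat.cast_zero, zero_mul] at hfail
    exact hfail.trans zero_le
  · rw [hV, Nat.cast_one, Real.one_rpow, div_one, ENNReal.ofReal_one]
    exact failProb_le_one _ _
  · have : Nontrivial V := Fintype.one_lt_card_iff_nontrivial.1 hV
    have hcast : ENNReal.ofReal (4 * (Fintype.card V : ℝ) ^ 3) =
        4 * (Fintype.card V : ℝ≥0∞) ^ 3 := by
      rw [ENNReal.ofReal_mul (by norm_num), ENNReal.ofReal_pow (by positivity),
        ENNReal.ofReal_natCast, ENNReal.ofReal_ofNat]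
    calc failProb (scheduleSmallSubgraph P H) (IsGoodRun (4 * P.γ) H)
        ≤ Fintype.card V * (Fintype.card V *
            (2 * (2 * Fintype.card V * ENNReal.ofReal ((31 / 32) ^ P.k)))) := by
          refine (failProb_scheduleSmallSubgraph_le
            (fun G => failProb_estimates_one_third_le P G ht) H).trans ?_
          gcongr
      _ = ENNReal.ofReal (4 * (Fintype.card V : ℝ) ^ 3 * (31 / 32) ^ P.k) := by
          rw [ENNReal.ofReal_mul (by positivity), hcast]
          ring
      _ ≤ ENNReal.ofReal (1 / (Fintype.card V : ℝ) ^ d) :=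
          ENNReal.ofReal_le_ofReal (four_mul_cube_mul_pow_le hV hk)

end GoodRun

end

end BatchScheduling

theorem mainTheorem6 :
    ∃ c₀ : ℕ, ∀ c : ℕ, c₀ ≤ c → ∀ d : ℝ, 1 ≤ d → ∃ c₁ : ℕ, ∀ c' : ℕ, c₁ ≤ c' →
      ∀ (V : Type*) [Fintype V] (P : BatchScheduling.Params V) (H : BatchScheduling.DAG V) (ρ : ℕ),
        1 < ρ → H.IsSmall ρ → P.γ < 1 / 4 → P.t = 9 * c →
        P.k = ⌈(c' : ℝ) * Real.log (Fintype.card V : ℝ)⌉₊ →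
        1 - 1 / (Fintype.card V : ℝ) ^ d ≤
          ((BatchScheduling.scheduleSmallSubgraph P H).toOuterMeasure
            {L | (L.length : ℝ) ≤ max 3 (4 * Real.logb (1 / (4 * P.γ)) (2 * (ρ : ℝ)))}).toReal := by
  refine ⟨80, fun c hc d _ => ⟨⌈(d + 5) / Real.log (32 / 31)⌉₊, ?_⟩⟩
  intro c' hc' V _ P H ρ _ hsmall hγ ht hk
  have hlength : ∀ L, BatchScheduling.IsGoodRun (4 * P.γ) H L →
      (L.length : ℝ) ≤ max 3 (4 * Real.logb (1 / (4 * P.γ)) (2 * (ρ : ℝ))) := fun L hL =>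
    hL.length_le (by linarith [P.γ_pos]) (by linarith) hsmall
  have hk' : (d + 5) / Real.log (32 / 31) * Real.log (Fintype.card V) ≤ P.k := by
    rw [hk]
    exact (mul_le_mul_of_nonneg_right (Nat.ceil_le.1 hc') (Real.log_natCast_nonneg _)).trans
      (Nat.le_ceil _)
  exact BatchScheduling.one_sub_le_toReal_of_failProb_le (by positivity)
    ((BatchScheduling.failProb_mono hlength).trans
      (BatchScheduling.failProb_isGoodRun_le P H (by omega) hk'))
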